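/- Let $(X_i,Y_i)_{i\ge 1}$ be i.i.d. random vectors in $\mathbb R^2$ whose marginal distribution functions $F$ (of $X_1$) and $G$ (of $Y_1$) are strictly increasing and differentiable on $\mathbb R$, with densities $f=F'$ and $g=G'$. Suppose that the copula of $(X_1,Y_1)$, i.e. the joint law of $(F(X_1),G(Y_1))$, has a density $c\ge 0$ with respect to Lebesgue measure on $[0,1]^2$, so that $f_{XY}(x,y)=f(x)g(y)c(F(x),G(y))$ is a joint density of $(X_1,Y_1)$, and let $$f(y|x)=\frac{f_{XY}(x,y)}{f(x)}=g(y)\,c(F(x),G(y)) .$$ Fix $x$ in the interior of $\{f>0\}$ and $y$ in the interior of $\{g>0\}$. Assume that $g$ is twice differentiable with continuous bounded second derivative on the interior of $\{g>0\}$, and that $c$ is twice differentiable with continuous bounded second derivatives on some open set $D\subset\mathbb R^2$ containing $(F(x),G(y))$ (for instance the interior of $\{c>0\}$, if it contains this point, or $(0,1)^2$). Let $K_0:\mathbb R\to\mathbb R$ and $K(u,v)=K_1(u)K_2(v)$ be kernels such that: $K_0$ and $K$ have bounded support; $K_0,K_1,K_2$ are of bounded variation; $0\le K_0\le C$ and $0\le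 K\le C$ for some constant $C$; $\int K_0=1$, $\int uK_0(u)\,du=0$, $\int u^2K_0(u)\,du<\infty$, and likewise $\int K=1$, $\int zK(z)\,dz=0$ (in $\mathbb R^2$), $\int |z|^2K(z)\,dz<\infty$; and $K$ is twice differentiable on $\mathbb R^2$ with bounded second partial derivatives. For bandwidths $h_n,a_n>0$ put $$F_n(s)=\frac1n\sum_{j=1}^n \mathbf 1_{X_j\le s},\qquad G_n(t)=\frac1n\sum_{j=1}^n\mathbf 1_{Y_j\le t},\qquad \hat g_n(t)=\frac1{nh_n}\sum_{i=1}^nK_0\Big(\frac{t-Y_i}{h_n}\Big),$$ $$\hat c_n(u,v)=\frac1{na_n^2}\sum_{i=1}^nK_1\Big(\frac{u-F_n(X_i)}{a_n}\Big)K_2\Big(\frac{v-G_n(Y_i)}{a_n}\Big),\qquad \hat f_n(y|x)=\hat g_n(y)\,\hat c_n(F_n(x),G_n(y)).$$ (1) If $h_n\to0$, $a_n\to0$, $nh_n\to\infty$ and $na_n^2\to\infty$, then $$\hat f_n(y|x)=f(y|x)+O_P\Big(\frac1{\sqrt{nh_n}}+h_n^2+\frac1{\sqrt{na_n^2}}+a_n^2\Big).$$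 (2) If $h_n\simeq n^{-1/5}$ and $a_n\simeq n^{-1/6}$, where $u_n\simeq v_n$ means $u_n=k_nv_n$ with $k_n\to k$ for some $k>0$, then $\hat f_n(y|x)=f(y|x)+O_P(n^{-1/3})$. Here $Z_n=O_P(r_n)$ means: for every $\varepsilon>0$ there is $M>0$ such that $P(|Z_n|>Mr_n)\le\varepsilon$ for all sufficiently large $n$. -/

import Mathlib

open MeasureTheory ProbabilityTheory Filter Set
open scoped Topology

noncomputable section

namespace QuantileCopula

/-- The c.d.f. `F` of the first coordinate of a law `μ` on the plane. -/
def cdfX (μ : Measure (ℝ × ℝ)) (x : ℝ) : ℝ := cdf μ.fst x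

/-- The c.d.f. `G` of the second coordinate of a law `μ` on the plane. -/
def cdfY (μ : Measure (ℝ × ℝ)) (y : ℝ) : ℝ := cdf μ.snd y

/-- The marginal density `f = F'`. -/
def densX (μ : Measure (ℝ × ℝ)) (x : ℝ) : ℝ := deriv (cdfX μ) x

/-- The marginal density `g = G'`. -/
def densY (μ : Measure (ℝ × ℝ)) (y : ℝ) : ℝ := deriv (cdfY μ) y

/-- The set where a density is positive. -/
def posSupp {E : Type*} (p : E → ℝ) : Set E := {z | 0 < p z}

/-- `c` is a copula density of the law `μ`: the copula of `μ`, that is the joint law of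
`(U, V) = (F(X), G(Y))` for `(X, Y) ~ μ`, has density `c` with respect to Lebesgue measure on
the unit square. -/
structure IsCopulaDensity (μ : Measure (ℝ × ℝ)) (c : ℝ × ℝ → ℝ) : Prop where
  measurable : Measurable c
  nonneg : ∀ p, 0 ≤ c p
  law_eq : μ.map (fun p => (cdfX μ p.1, cdfY μ p.2)) =
    ((volume : Measure (ℝ × ℝ)).restrict (Icc 0 1 ×ˢ Icc 0 1)).withDensity
      (fun p => ENNReal.ofReal (c p))

/-- The joint density `f_{XY}(x, y) = f(x) g(y) c(F(x), G(y))`. -/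
def jointDensity (μ : Measure (ℝ × ℝ)) (c : ℝ × ℝ → ℝ) (x y : ℝ) : ℝ :=
  densX μ x * densY μ y * c (cdfX μ x, cdfY μ y)

/-- The conditional density `f(y|x) = f_{XY}(x, y) / f(x)`. -/
def condDensity (μ : Measure (ℝ × ℝ)) (c : ℝ × ℝ → ℝ) (x y : ℝ) : ℝ :=
  jointDensity μ c x y / densX μ x

/-- `jointDensity` is indeed a density of the law `μ`. -/
theorem IsCopulaDensity.law_eq_withDensity {μ : Measure (ℝ × ℝ)} [IsProbabilityMeasure μ]
    {c : ℝ × ℝ → ℝ} (hc : IsCopulaDensity μ c)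
    (hF : StrictMono (cdfX μ)) (hF' : Differentiable ℝ (cdfX μ))
    (hG : StrictMono (cdfY μ)) (hG' : Differentiable ℝ (cdfY μ)) :
    μ = (volume : Measure (ℝ × ℝ)).withDensity
      (fun p => ENNReal.ofReal (jointDensity μ c p.1 p.2)) := by
  set T : ℝ × ℝ → ℝ × ℝ := fun p => (cdfX μ p.1, cdfY μ p.2) with hT
  have hTm : Measurable T :=
    (hF'.continuous.measurable.comp measurable_fst).prodMk
      (hG'.continuous.measurable.comp measurable_snd)
  have hTi : Function.Injective T := by
    rintro ⟨a, b⟩ ⟨a', b'⟩ h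
    simp only [hT, Prod.mk.injEq] at h
    exact Prod.ext (hF.injective h.1) (hG.injective h.2)
  have hTe : MeasurableEmbedding T := hTm.measurableEmbedding hTi
  have hd : ∀ p : ℝ × ℝ, HasFDerivAt T
      ((ContinuousLinearMap.toSpanSingleton ℝ (densX μ p.1)).prodMap
        (ContinuousLinearMap.toSpanSingleton ℝ (densY μ p.2))) p := by
    intro p
    exact HasFDerivAt.prodMap p (hF' p.1).hasDerivAt.hasFDerivAt (hG' p.2).hasDerivAt.hasFDerivAt
  have hdet : ∀ p : ℝ × ℝ, ((ContinuousLinearMap.toSpanSingleton ℝ (densX μ p.1)).prodMap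
        (ContinuousLinearMap.toSpanSingleton ℝ (densY μ p.2))).det
        = densX μ p.1 * densY μ p.2 := by
    intro p
    rw [ContinuousLinearMap.det, ContinuousLinearMap.coe_prodMap, LinearMap.det_prodMap]
    simp
  have hpos : ∀ p : ℝ × ℝ, 0 ≤ densX μ p.1 * densY μ p.2 := fun p =>
    mul_nonneg (hF.monotone.deriv_nonneg) (hG.monotone.deriv_nonneg)
  ext s hs
  have himg : T '' s ⊆ Icc 0 1 ×ˢ Icc 0 1 := by
    rintro _ ⟨p, -, rfl⟩
    exact ⟨⟨cdf_nonneg _ _, cdf_le_one _ _⟩, ⟨cdf_nonneg _ _, cdf_le_one _ _⟩⟩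
  have hTs : MeasurableSet (T '' s) := hTe.measurableSet_image.2 hs
  calc μ s = (μ.map T) (T '' s) := by
        rw [hTe.map_apply, hTi.preimage_image]
    _ = ∫⁻ p in T '' s, ENNReal.ofReal (c p) := by
        rw [hT, hc.law_eq, withDensity_apply _ hTs, Measure.restrict_restrict hTs,
          inter_eq_self_of_subset_left himg]
    _ = _ := by
        rw [lintegral_image_eq_lintegral_abs_det_fderiv_mul volume hs
          (fun p _ => (hd p).hasFDerivWithinAt) hTi.injOn, withDensity_apply _ hs]
        refine lintegral_congr fun p => ?_
        rw [hdet, abs_of_nonneg (hpos p), ← ENNReal.ofReal_mul (hpos p)]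
        rfl

/-- The conditions common to the univariate and the bivariate kernel: bounded support,
`0 ≤ K ≤ C` for some constant `C`, `m₀(K) = 1`, `m₁(K) = 0` and `m₂(K) < ∞`. -/
structure IsFirstOrderKernel {E : Type*} [NormedAddCommGroup E] [NormedSpace ℝ E]
    [MeasureSpace E] (K : E → ℝ) : Prop where
  bounded_support : Bornology.IsBounded (Function.support K)
  bounded : ∃ C, ∀ z, 0 ≤ K z ∧ K z ≤ C
  moment_zero : ∫ z, K z = 1
  moment_one : ∫ z, K z • z = 0
  moment_two : Integrable (fun z => ‖z‖ ^ 2 * K z)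

/-- The product kernel `K(u, v) = K₁(u) K₂(v)`. -/
def prodKernel (K₁ K₂ : ℝ → ℝ) (p : ℝ × ℝ) : ℝ := K₁ p.1 * K₂ p.2

/-- `φ` is twice differentiable everywhere with bounded second derivative. -/
def TwiceDiffBounded (φ : ℝ × ℝ → ℝ) : Prop :=
  Differentiable ℝ φ ∧ Differentiable ℝ (fderiv ℝ φ) ∧
    ∃ M, ∀ p, ‖fderiv ℝ (fderiv ℝ φ) p‖ ≤ M

/-- `φ` is twice differentiable on the open set `D`, with continuous and bounded second
derivative there. -/
def C2BoundedOn {E : Type*} [NormedAddCommGroup E] [NormedSpace ℝ E]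
    (φ : E → ℝ) (D : Set E) : Prop :=
  ContDiffOn ℝ 2 φ D ∧ ∃ M, ∀ p ∈ D, ‖iteratedFDeriv ℝ 2 φ p‖ ≤ M

/-- The kernel density estimator `ĝ_n(y) = (n h)⁻¹ ∑ K₀((y - Y_i) / h)`, for data `Y`. -/
def kde (K₀ : ℝ → ℝ) (n : ℕ) (h : ℝ) (Y : ℕ → ℝ) (y : ℝ) : ℝ :=
  1 / (n * h) * ∑ i ∈ Finset.range n, K₀ ((y - Y i) / h)

/-- The empirical distribution function of the first `n` data points. -/
def ecdf (n : ℕ) (X : ℕ → ℝ) (x : ℝ) : ℝ :=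
  1 / n * ∑ j ∈ Finset.range n, (Iic x).indicator (fun _ => (1 : ℝ)) (X j)

/-- The copula density estimator
`ĉ_n(u, v) = (n a²)⁻¹ ∑ K((u - F_n(X_i)) / a, (v - G_n(Y_i)) / a)`. -/
def copulaEstimator (K : ℝ × ℝ → ℝ) (n : ℕ) (a : ℝ) (X Y : ℕ → ℝ) (u v : ℝ) : ℝ :=
  1 / (n * a ^ 2) *
    ∑ i ∈ Finset.range n, K ((u - ecdf n X (X i)) / a, (v - ecdf n Y (Y i)) / a)

/-- The quantile-copula estimator `f̂_n(y|x) = ĝ_n(y) ĉ_n(F_n(x), G_n(y))`. -/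
def condEstimator (K₀ : ℝ → ℝ) (K : ℝ × ℝ → ℝ) (n : ℕ) (h a : ℝ) (X Y : ℕ → ℝ)
    (x y : ℝ) : ℝ :=
  kde K₀ n h Y y * copulaEstimator K n a X Y (ecdf n X x) (ecdf n Y y)

/-- `Z_n = O_P(r_n)`: for every `ε > 0` there is `M` such that `P(|Z_n| > M r_n) ≤ ε` for all
large `n`. -/
def IsBigOP {Ω : Type*} [MeasurableSpace Ω] (P : Measure Ω) (Z : ℕ → Ω → ℝ) (r : ℕ → ℝ) :
    Prop :=
  ∀ ε : ℝ, 0 < ε → ∃ M : ℝ, 0 < M ∧ ∀ᶠ n in atTop,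
    P {ω | M * r n < |Z n ω|} ≤ ENNReal.ofReal ε

/-- `h_n ≃ u_n`: `h_n = k_n u_n` for `n ≥ 1`, with `k_n → l > 0`. -/
def OrderEquiv (h u : ℕ → ℝ) : Prop :=
  ∃ (k : ℕ → ℝ) (l : ℝ), 0 < l ∧ Tendsto k atTop (𝓝 l) ∧ ∀ n, 1 ≤ n → h n = k n * u n

end QuantileCopula

end

noncomputable section

namespace QuantileCopula

/-! ### Calculus of stochastic orders -/

section BigOP

variable {Ω : Type*} [MeasurableSpace Ω] {P : Measure Ω} {Z W : ℕ → Ω → ℝ} {r s : ℕ → ℝ}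

/-! The conditional density factors as `g(y) c(F(x), G(y))`, so the error of the product estimator
is `(ĝ - g)(ĉ - c) + c (ĝ - g) + g (ĉ - c)`, and each factor is treated separately.

If `F` and `G` were known, `ĉ` would be an ordinary kernel estimator built on the i.i.d. points
`(F(X_i), G(Y_i))`, evaluated in the interior of the unit square. A bias-variance bound, valid in
any finite dimension `d`, then covers both factors (`isBigOP_kernelAverage`): Taylor expansion and
the vanishing first moment give a bias of order `b²`, and bounded kernels give a variance of order
`1 / (n b^d)`.

The cost of using `F_n`, `G_n` instead is the heart of the proof (`isBigOP_copulaEstimator_sub`).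
The kernel argument changes by `1 / a` times the increment of the centred empirical process `F_n -
F` between `x` and `X_i`, plus the analogue for `Y`. The kernel is Lipschitz, and only sample points
in a box of side of order `a` around `(F(x), G(y))` count, an event of probability `O(a²)`.
Conditionally on the `i`-th point the increment is a nearly centred average, so its mean square,
restricted to the box, is `O(a² / n)`. The total effect is `(n a²)⁻¹ · n · a⁻¹ · a² · n^{-1/2} = 1 /
√(n a²)`: the crude `1 / √n` size of the increments is enough, with no use of their smallness near
`x`.

That points outside the box cannot enter the support after replacement requires no uniform
convergence of `F_n`: by monotonicity, closeness of `F_n` to `F` at `x` and at two quantiles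
suffices (`exists_ecdf_separation`). -/

theorem IsBigOP.mono_rate (hZ : IsBigOP P Z r) {C : ℝ} (hC : 0 < C)
    (hrs : ∀ᶠ n in atTop, r n ≤ C * s n) : IsBigOP P Z s := by
  intro ε hε
  obtain ⟨M, hM, h⟩ := hZ ε hε
  refine ⟨M * C, by positivity, ?_⟩
  filter_upwards [h, hrs] with n hn hrn
  refine (measure_mono fun ω hω => ?_).trans hn
  simp only [mem_ofPred_eq] at hω ⊢
  nlinarith

theorem IsBigOP.add (hZ : IsBigOP P Z r) (hW : IsBigOP P W s)
    (hr : ∀ᶠ n in atTop, 0 ≤ r n) (hs : ∀ᶠ n in atTop, 0 ≤ s n) :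
    IsBigOP P (fun n ω => Z n ω + W n ω) (fun n => r n + s n) := by
  intro ε hε
  obtain ⟨M, hM, h⟩ := hZ (ε / 2) (by positivity)
  obtain ⟨N, hN, h'⟩ := hW (ε / 2) (by positivity)
  refine ⟨M + N, by positivity, ?_⟩
  filter_upwards [h, h', hr, hs] with n hn hn' hrn hsn
  calc P {ω | (M + N) * (r n + s n) < |Z n ω + W n ω|}
      ≤ P ({ω | M * r n < |Z n ω|} ∪ {ω | N * s n < |W n ω|}) := by
        refine measure_mono fun ω hω => ?_
        simp only [mem_ofPred_eq, mem_union] at hω ⊢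
        by_contra! hcon
        nlinarith [abs_add_le (Z n ω) (W n ω), mul_nonneg hM.le hsn, mul_nonneg hN.le hrn]
    _ ≤ _ := measure_union_le _ _
    _ ≤ ENNReal.ofReal (ε / 2) + ENNReal.ofReal (ε / 2) := add_le_add hn hn'
    _ = ENNReal.ofReal ε := by
        rw [← ENNReal.ofReal_add (by positivity) (by positivity), add_halves]

theorem IsBigOP.mul (hZ : IsBigOP P Z r) (hW : IsBigOP P W s)
    (hr : ∀ᶠ n in atTop, 0 ≤ r n) :
    IsBigOP P (fun n ω => Z n ω * W n ω) (fun n => r n * s n) := by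
  intro ε hε
  obtain ⟨M, hM, h⟩ := hZ (ε / 2) (by positivity)
  obtain ⟨N, hN, h'⟩ := hW (ε / 2) (by positivity)
  refine ⟨M * N, by positivity, ?_⟩
  filter_upwards [h, h', hr] with n hn hn' hrn
  calc P {ω | (M * N) * (r n * s n) < |Z n ω * W n ω|}
      ≤ P ({ω | M * r n < |Z n ω|} ∪ {ω | N * s n < |W n ω|}) := by
        refine measure_mono fun ω hω => ?_
        simp only [mem_ofPred_eq, mem_union] at hω ⊢
        by_contra! hcon
        rw [abs_mul] at hω
        have := mul_le_mul hcon.1 hcon.2 (abs_nonneg _) (by positivity)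
        nlinarith
    _ ≤ _ := measure_union_le _ _
    _ ≤ ENNReal.ofReal (ε / 2) + ENNReal.ofReal (ε / 2) := add_le_add hn hn'
    _ = ENNReal.ofReal ε := by
        rw [← ENNReal.ofReal_add (by positivity) (by positivity), add_halves]

/-- A deterministic sequence bounded by the rate. -/
theorem IsBigOP.of_abs_le {z : ℕ → ℝ} {C : ℝ} (hC : 0 < C)
    (h : ∀ᶠ n in atTop, |z n| ≤ C * r n) : IsBigOP P (fun n _ => z n) r := by
  intro ε _
  refine ⟨C, hC, ?_⟩
  filter_upwards [h] with n hn
  simp [not_lt.2 hn]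

theorem IsBigOP.const_mul (hZ : IsBigOP P Z r) (k : ℝ) (hr : ∀ᶠ n in atTop, 0 ≤ r n) :
    IsBigOP P (fun n ω => k * Z n ω) r := by
  intro ε hε
  obtain ⟨M, hM, h⟩ := hZ ε hε
  refine ⟨(|k| + 1) * M, by positivity, ?_⟩
  filter_upwards [h, hr] with n hn hrn
  refine (measure_mono fun ω hω => ?_).trans hn
  simp only [mem_ofPred_eq] at hω ⊢
  rw [abs_mul] at hω
  by_contra! hcon
  nlinarith [mul_le_mul_of_nonneg_left hcon (abs_nonneg k), mul_nonneg hM.le hrn]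

/-- Domination outside of events whose probability tends to zero. -/
theorem IsBigOP.of_le_outside (hW : IsBigOP P W r) {A : ℕ → Set Ω}
    (hA : Tendsto (fun n => P (A n)) atTop (𝓝 0))
    (h : ∀ᶠ n in atTop, ∀ ω, ω ∉ A n → |Z n ω| ≤ |W n ω|) : IsBigOP P Z r := by
  intro ε hε
  obtain ⟨M, hM, h'⟩ := hW (ε / 2) (by positivity)
  have hev : ∀ᶠ n in atTop, P (A n) ≤ ENNReal.ofReal (ε / 2) :=
    hA.eventually (Iic_mem_nhds (by simpa using hε))
  refine ⟨M, hM, ?_⟩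
  filter_upwards [h, h', hev] with n hn hn' hAn
  calc P {ω | M * r n < |Z n ω|}
      ≤ P ({ω | M * r n < |W n ω|} ∪ A n) := by
        refine measure_mono fun ω hω => ?_
        by_cases hωA : ω ∈ A n
        · exact Or.inr hωA
        · exact Or.inl (lt_of_lt_of_le hω (hn ω hωA))
    _ ≤ _ := measure_union_le _ _
    _ ≤ ENNReal.ofReal (ε / 2) + ENNReal.ofReal (ε / 2) := add_le_add hn' hAn
    _ = ENNReal.ofReal ε := by
        rw [← ENNReal.ofReal_add (by positivity) (by positivity), add_halves]

variable [IsProbabilityMeasure P]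

/-- Markov's inequality, with `M = C / ε`. -/
theorem isBigOP_of_integral_le {C : ℝ} (hC : 0 < C) (hr : ∀ᶠ n in atTop, 0 < r n)
    (hint : ∀ᶠ n in atTop, Integrable (W n) P) (hnn : ∀ᶠ n in atTop, ∀ ω, 0 ≤ W n ω)
    (hle : ∀ᶠ n in atTop, ∫ ω, W n ω ∂P ≤ C * r n) : IsBigOP P W r := by
  intro ε hε
  refine ⟨C / ε, by positivity, ?_⟩
  filter_upwards [hr, hint, hnn, hle] with n hrn hi hn hl
  have hpos : 0 < C / ε * r n := by positivity
  have key := mul_meas_ge_le_integral_of_nonneg (ae_of_all P hn) hi (C / ε * r n)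
  have hreal : P.real {ω | C / ε * r n ≤ W n ω} ≤ ε := by
    have h1 : C / ε * r n * P.real {ω | C / ε * r n ≤ W n ω} ≤ C / ε * r n * ε := by
      refine (key.trans hl).trans (le_of_eq ?_)
      field_simp
    exact le_of_mul_le_mul_left h1 hpos
  calc P {ω | C / ε * r n < |W n ω|} ≤ P {ω | C / ε * r n ≤ W n ω} := by
        refine measure_mono fun ω hω => ?_
        simp only [mem_ofPred_eq] at hω ⊢
        rw [abs_of_nonneg (hn ω)] at hω
        exact hω.le
    _ = ENNReal.ofReal (P.real {ω | C / ε * r n ≤ W n ω}) := by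
        rw [ofReal_measureReal]
    _ ≤ ENNReal.ofReal ε := ENNReal.ofReal_le_ofReal hreal

theorem isBigOP_of_integral_sq_le {C : ℝ} (hC : 0 < C) (hr : ∀ᶠ n in atTop, 0 < r n)
    (hint : ∀ᶠ n in atTop, Integrable (fun ω => Z n ω ^ 2) P)
    (hle : ∀ᶠ n in atTop, ∫ ω, Z n ω ^ 2 ∂P ≤ C * r n ^ 2) : IsBigOP P Z r := by
  have h2 : IsBigOP P (fun n ω => Z n ω ^ 2) (fun n => r n ^ 2) :=
    isBigOP_of_integral_le hC (hr.mono fun n hn => by positivity) hint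
      (Eventually.of_forall fun n ω => sq_nonneg _) hle
  intro ε hε
  obtain ⟨M, hM, h⟩ := h2 ε hε
  refine ⟨√M, by positivity, ?_⟩
  filter_upwards [h, hr] with n hn hrn
  refine (measure_mono fun ω hω => ?_).trans hn
  simp only [mem_ofPred_eq] at hω ⊢
  rw [abs_of_nonneg (sq_nonneg _), ← sq_abs (Z n ω)]
  calc M * r n ^ 2 = (√M * r n) ^ 2 := by rw [mul_pow, Real.sq_sqrt hM.le]
    _ < _ := by gcongr

end BigOP

/-! ### Variance of empirical averages -/

section Average

variable {Ω : Type*} [MeasurableSpace Ω] {P : Measure Ω} [IsProbabilityMeasure P]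
  {S : Type*} [MeasurableSpace S] {ν : Measure S} {Z : ℕ → Ω → S}

/-- Mean square deviation of an empirical average of a bounded function. -/
theorem integral_sq_average_sub_le (hZ : ∀ i, Measurable (Z i)) (hind : iIndepFun Z P)
    (hlaw : ∀ i, P.map (Z i) = ν) {q : S → ℝ} (hq : Measurable q) {C : ℝ}
    (hC : ∀ z, |q z| ≤ C) {n : ℕ} (hn : 1 ≤ n) :
    Integrable (fun ω => (1 / n * ∑ i ∈ Finset.range n, q (Z i ω) - ∫ z, q z ∂ν) ^ 2) P ∧
      ∫ ω, (1 / n * ∑ i ∈ Finset.range n, q (Z i ω) - ∫ z, q z ∂ν) ^ 2 ∂P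
        ≤ 1 / n * ∫ z, q z ^ 2 ∂ν := by
  have hn0 : (n : ℝ) ≠ 0 := by positivity
  have hm : ∀ i, Measurable (fun ω => q (Z i ω)) := fun i => hq.comp (hZ i)
  have hLp : ∀ i, MemLp (fun ω => q (Z i ω)) 2 P := fun i =>
    MemLp.of_bound (hm i).aestronglyMeasurable C (ae_of_all _ fun ω => hC _)
  have hmean : ∀ i, ∫ ω, q (Z i ω) ∂P = ∫ z, q z ∂ν := fun i => by
    rw [← hlaw i, integral_map (hZ i).aemeasurable hq.aestronglyMeasurable]
  have hsq : ∀ i, ∫ ω, q (Z i ω) ^ 2 ∂P = ∫ z, q z ^ 2 ∂ν := fun i => by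
    rw [← hlaw i, integral_map (hZ i).aemeasurable (hq.pow_const 2).aestronglyMeasurable]
  set A : Ω → ℝ := fun ω => 1 / n * ∑ i ∈ Finset.range n, q (Z i ω) with hA
  have hALp : MemLp A 2 P := (memLp_finsetSum _ fun i _ => hLp i).const_mul _
  have hEA : ∫ ω, A ω ∂P = ∫ z, q z ∂ν := by
    simp only [hA]
    rw [integral_const_mul, integral_finsetSum _ fun i _ => (hLp i).integrable one_le_two,
      Finset.sum_congr rfl fun i _ => hmean i]
    simp [hn0]
  refine ⟨(hALp.sub (memLp_const _)).integrable_sq, ?_⟩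
  have hvar : Var[A; P] = ∫ ω, (A ω - ∫ z, q z ∂ν) ^ 2 ∂P := by
    rw [variance_eq_integral hALp.1.aemeasurable, hEA]
  rw [← hvar, hA, variance_const_mul]
  have hsum : Var[fun ω => ∑ i ∈ Finset.range n, q (Z i ω); P]
      = ∑ i ∈ Finset.range n, Var[fun ω => q (Z i ω); P] := by
    rw [← IndepFun.variance_sum (fun i _ => hLp i)]
    · congr 1
      ext ω
      simp
    · intro i _ j _ hij
      exact (hind.indepFun hij).comp hq hq
  rw [hsum]
  calc (1 / (n : ℝ)) ^ 2 * ∑ i ∈ Finset.range n, Var[fun ω => q (Z i ω); P]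
      ≤ (1 / (n : ℝ)) ^ 2 * ∑ i ∈ Finset.range n, ∫ z, q z ^ 2 ∂ν := by
        gcongr with i
        rw [← hsq i]
        exact variance_le_expectation_sq (hm i).aestronglyMeasurable
    _ = 1 / n * ∫ z, q z ^ 2 ∂ν := by
        rw [Finset.sum_const, Finset.card_range, nsmul_eq_mul]
        field_simp

end Average

/-! ### Measures with a density on a set -/

section Density

variable {S : Type*} [MeasureSpace S]

/-- `ν` has density `φ` on the set `U`. -/
structure HasDensityOn (ν : Measure S) (φ : S → ℝ) (U : Set S) : Prop where
  measurable : Measurable φ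
  measurableSet : MeasurableSet U
  nonneg : ∀ z ∈ U, 0 ≤ φ z
  restrict_eq : ν.restrict U = (volume.restrict U).withDensity fun z => ENNReal.ofReal (φ z)

/-- A density on `U` alone suffices because rescaled kernels are eventually supported in `U`. The
same argument thus serves `g` on `univ` and `c` on the unit square. -/
theorem HasDensityOn.integral_eq {ν : Measure S} {φ : S → ℝ} {U : Set S}
    (h : HasDensityOn ν φ U) {q : S → ℝ} (hq : ∀ z ∉ U, q z = 0) :
    ∫ z, q z ∂ν = ∫ z, φ z * q z := by
  rw [← setIntegral_eq_integral_of_forall_compl_eq_zero hq, h.restrict_eq,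
    integral_withDensity_eq_integral_toReal_smul h.measurable.ennreal_ofReal (by simp),
    ← setIntegral_eq_integral_of_forall_compl_eq_zero (s := U) (f := fun z => φ z * q z)
      fun z hz => by simp [hq z hz]]
  refine setIntegral_congr_fun h.measurableSet fun z hz => ?_
  simp [ENNReal.toReal_ofReal (h.nonneg z hz)]

end Density

/-! ### Bias and variance of kernel estimators -/

section Kernel

variable {E : Type*} [NormedAddCommGroup E] [NormedSpace ℝ E]

/-- Second order Taylor bound near a point of twice continuous differentiability. -/
theorem exists_taylor_bound {φ : E → ℝ} {p : E} (hφ : ContDiffAt ℝ 2 φ p) :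
    ∃ r > 0, ∃ M ≥ 0, ∀ z ∈ Metric.ball p r,
      |φ z - φ p - fderiv ℝ φ p (z - p)| ≤ M * ‖z - p‖ ^ 2 := by
  obtain ⟨M, t, ht, hlip⟩ := (hφ.fderiv_right (m := 1) (by norm_num)).exists_lipschitzOnWith
  have hd : ∀ᶠ z in 𝓝 p, DifferentiableAt ℝ φ z :=
    (hφ.eventually (by simp)).mono fun z hz => hz.differentiableAt (by simp)
  obtain ⟨r, hr, hball⟩ := Metric.eventually_nhds_iff_ball.1 (hd.and ht)
  refine ⟨r, hr, M, M.2, fun z hz => ?_⟩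
  -- On the ball of radius `‖z - p‖` the derivative moves by at most `M * ‖z - p‖`; the mean value
  -- inequality contributes the second factor `‖z - p‖`.
  have hsub : Metric.closedBall p ‖z - p‖ ⊆ Metric.ball p r :=
    Metric.closedBall_subset_ball (by rwa [mem_ball_iff_norm] at hz)
  have h := (convex_closedBall p ‖z - p‖).norm_image_sub_le_of_norm_hasFDerivWithin_le'
    (f := φ) (f' := fderiv ℝ φ) (φ := fderiv ℝ φ p) (C := M * ‖z - p‖) (x := p) (y := z)
    (fun w hw => (hball w (hsub hw)).1.hasFDerivAt.hasFDerivWithinAt)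
    (fun w hw => ?_) (by simp) (mem_closedBall_iff_norm.2 le_rfl)
  · rw [Real.norm_eq_abs] at h
    linarith [h, show (M : ℝ) * ‖z - p‖ * ‖z - p‖ = M * ‖z - p‖ ^ 2 by ring]
  · refine (hlip.norm_sub_le (hball w (hsub hw)).2 (mem_of_mem_nhds ht)).trans ?_
    rw [mem_closedBall_iff_norm] at hw
    gcongr

variable [MeasureSpace E]

theorem IsFirstOrderKernel.exists_radius {K : E → ℝ} (hK : IsFirstOrderKernel K) :
    ∃ R > 0, ∀ z, K z ≠ 0 → ‖z‖ ≤ R := by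
  obtain ⟨R, hR⟩ := hK.bounded_support.exists_norm_le
  exact ⟨max R 1, by positivity, fun z hz => (hR z hz).trans (le_max_left _ _)⟩

theorem IsFirstOrderKernel.exists_bound {K : E → ℝ} (hK : IsFirstOrderKernel K) :
    ∃ C > 0, ∀ z, K z ≤ C := by
  obtain ⟨C, hC⟩ := hK.bounded
  exact ⟨max C 1, by positivity, fun z => (hC z).2.trans (le_max_left _ _)⟩

theorem IsFirstOrderKernel.nonneg {K : E → ℝ} (hK : IsFirstOrderKernel K) (z : E) : 0 ≤ K z := by
  obtain ⟨C, hC⟩ := hK.bounded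
  exact (hC z).1

theorem IsFirstOrderKernel.integrable {K : E → ℝ} (hK : IsFirstOrderKernel K) :
    Integrable K := by
  -- The integral of a non-integrable function is `0`, while `moment_zero` gives `1`.
  by_contra h
  simpa [integral_undef h] using hK.moment_zero

variable [BorelSpace E] [FiniteDimensional ℝ E] [(volume : Measure E).IsAddHaarMeasure]

/-- The smoothing bias of a first order kernel is quadratic in the bandwidth. -/
theorem exists_bias_bound {K : E → ℝ} (hK : IsFirstOrderKernel K) (hKm : Measurable K)
    {ν : Measure E} {φ : E → ℝ} {p : E} (hφ : ContDiffAt ℝ 2 φ p) {U : Set E} (hU : U ∈ 𝓝 p)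
    (hν : HasDensityOn ν φ U) :
    ∃ δ > 0, ∃ M > 0, ∀ b, 0 < b → b < δ →
      |∫ z, K (b⁻¹ • (p - z)) ∂ν - b ^ Module.finrank ℝ E * φ p|
        ≤ M * b ^ Module.finrank ℝ E * b ^ 2 := by
  obtain ⟨r, hr, M, hM, htay⟩ := exists_taylor_bound hφ
  obtain ⟨r', hr', hball⟩ := Metric.mem_nhds_iff.1 hU
  obtain ⟨R, hR, hsupp⟩ := hK.exists_radius
  obtain ⟨C, hC, hbd⟩ := hK.exists_bound
  have hm2 : 0 ≤ ∫ w, ‖w‖ ^ 2 * K w :=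
    integral_nonneg fun w => mul_nonneg (by positivity) (hK.nonneg w)
  -- For `b * R < min r r'` the kernel window lies both where the Taylor bound holds and inside `U`;
  -- the `+ 1` only secures positivity.
  refine ⟨min r r' / R, by positivity, M * (∫ w, ‖w‖ ^ 2 * K w) + 1, by positivity,
    fun b hb hbδ => ?_⟩
  rw [lt_div_iff₀ hR, lt_min_iff] at hbδ
  set d := Module.finrank ℝ E
  have hbd : 0 < b ^ d := by positivity
  -- Change of variables `z = p - b • w`, with Jacobian `b ^ d`.
  have h1 : ∫ z, K (b⁻¹ • (p - z)) ∂ν = b ^ d * ∫ w, φ (p - b • w) * K w := by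
    rw [hν.integral_eq]
    · have : ∀ z, φ z * K (b⁻¹ • (p - z))
          = (fun u => (fun w => φ (p - b • w) * K w) (b⁻¹ • u)) (p - z) := fun z => by
        simp [smul_smul, hb.ne']
      simp_rw [this]
      rw [integral_sub_left_eq_self (fun u => (fun w => φ (p - b • w) * K w) (b⁻¹ • u)),
        Measure.integral_comp_inv_smul volume fun w => φ (p - b • w) * K w, abs_of_pos hbd, smul_eq_mul]
    · intro z hz
      by_contra hne
      refine hz (hball ?_)
      have := hsupp _ hne
      rw [norm_smul, norm_inv, Real.norm_of_nonneg hb.le, inv_mul_le_iff₀ hb] at this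
      rw [mem_ball_iff_norm']
      linarith [hbδ.2]
  -- The Taylor remainder weighted by the kernel; the plus sign comes from the increment `-b • w`.
  -- The linear term itself integrates to zero by `moment_one`.
  set e : E → ℝ := fun w => K w * (φ (p - b • w) - φ p + fderiv ℝ φ p (b • w)) with he
  have hebd : ∀ w, ‖e w‖ ≤ M * b ^ 2 * (‖w‖ ^ 2 * K w) := by
    intro w
    by_cases hw : K w = 0
    · simp [he, hw]
    have hb' : p - b • w ∈ Metric.ball p r := by
      rw [mem_ball_iff_norm']
      have := hsupp w hw
      simp only [sub_sub_cancel, norm_smul, Real.norm_of_nonneg hb.le]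
      nlinarith [hbδ.1]
    have ht := htay _ hb'
    simp only [sub_sub_cancel_left, map_neg, sub_neg_eq_add, norm_neg, norm_smul,
      Real.norm_of_nonneg hb.le] at ht
    rw [he, norm_mul, Real.norm_of_nonneg (hK.nonneg w), Real.norm_eq_abs]
    calc K w * |φ (p - b • w) - φ p + fderiv ℝ φ p (b • w)| ≤ K w * (M * (b * ‖w‖) ^ 2) :=
          mul_le_mul_of_nonneg_left ht (hK.nonneg w)
      _ = _ := by ring
  have hem : Measurable e := by
    have hφm := hν.measurable
    have : Measurable (fderiv ℝ φ p) := (fderiv ℝ φ p).continuous.measurable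
    fun_prop
  have hei : Integrable e :=
    (hK.moment_two.const_mul (M * b ^ 2)).mono' hem.aestronglyMeasurable (ae_of_all _ hebd)
  have hK1 : Integrable fun w => K w • w := by
    refine (hK.integrable.norm.const_mul R).mono'
      (hKm.smul measurable_id).aestronglyMeasurable (ae_of_all _ fun w => ?_)
    by_cases hw : K w = 0
    · simp [hw]
    · rw [norm_smul, mul_comm]
      exact mul_le_mul_of_nonneg_right (hsupp w hw) (norm_nonneg _)
  have h2 : ∫ w, φ (p - b • w) * K w = φ p + ∫ w, e w := by
    have hpt : ∀ w, φ (p - b • w) * K w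
        = φ p * K w - b * fderiv ℝ φ p (K w • w) + e w := fun w => by
      simp only [he, map_smul, smul_eq_mul]
      ring
    have hL : Integrable fun w => b * fderiv ℝ φ p (K w • w) :=
      ((fderiv ℝ φ p).integrable_comp hK1).const_mul b
    have hKL : Integrable fun w => φ p * K w - b * fderiv ℝ φ p (K w • w) :=
      (hK.integrable.const_mul _).sub hL
    simp_rw [hpt]
    rw [integral_add hKL hei,
      integral_sub (hK.integrable.const_mul _) hL, integral_const_mul, integral_const_mul,
      ContinuousLinearMap.integral_comp_comm _ hK1, hK.moment_zero, hK.moment_one]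
    simp
  have h3 : |∫ w, e w| ≤ M * b ^ 2 * ∫ w, ‖w‖ ^ 2 * K w := by
    rw [← integral_const_mul, ← Real.norm_eq_abs]
    exact norm_integral_le_of_norm_le (hK.moment_two.const_mul _) (ae_of_all _ hebd)
  rw [h1, h2, mul_add, add_sub_cancel_left, abs_mul, abs_of_pos hbd]
  calc b ^ d * |∫ w, e w| ≤ b ^ d * (M * b ^ 2 * ∫ w, ‖w‖ ^ 2 * K w) := by gcongr
    _ ≤ (M * (∫ w, ‖w‖ ^ 2 * K w) + 1) * b ^ d * b ^ 2 := by
        have : 0 ≤ b ^ d * b ^ 2 := by positivity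
        nlinarith

variable {Ω : Type*} [MeasurableSpace Ω] {P : Measure Ω} [IsProbabilityMeasure P]
  {ν : Measure E} {Z : ℕ → Ω → E}

/-- The pointwise rate of convergence of a kernel density estimator. -/
theorem isBigOP_kernelAverage (hZ : ∀ i, Measurable (Z i)) (hind : iIndepFun Z P)
    (hlaw : ∀ i, P.map (Z i) = ν) {K : E → ℝ} (hK : IsFirstOrderKernel K) (hKm : Measurable K)
    {φ : E → ℝ} {p : E} (hφ : ContDiffAt ℝ 2 φ p) {U : Set E} (hU : U ∈ 𝓝 p)
    (hν : HasDensityOn ν φ U) {b : ℕ → ℝ} (hb : ∀ᶠ n in atTop, 0 < b n)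
    (hb0 : Tendsto b atTop (𝓝 0)) :
    IsBigOP P (fun n ω => 1 / (n * b n ^ Module.finrank ℝ E) *
        ∑ i ∈ Finset.range n, K ((b n)⁻¹ • (p - Z i ω)) - φ p)
      (fun n => 1 / √(n * b n ^ Module.finrank ℝ E) + b n ^ 2) := by
  obtain ⟨δ, hδ, M, hM, hbias⟩ := exists_bias_bound hK hKm hφ hU hν
  obtain ⟨C, hC, hKC⟩ := hK.exists_bound
  set d := Module.finrank ℝ E
  have hbδ : ∀ᶠ n in atTop, b n < min δ 1 := hb0.eventually (Iio_mem_nhds (by positivity))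
  have hn1 : ∀ᶠ n : ℕ in atTop, 1 ≤ n := eventually_ge_atTop 1
  set m : ℕ → ℝ := fun n => ∫ z, K ((b n)⁻¹ • (p - z)) ∂ν with hm
  have hφp : 0 ≤ φ p := hν.nonneg p (mem_of_mem_nhds hU)
  have hKnm : ∀ n, Measurable fun z => K ((b n)⁻¹ • (p - z)) := fun n => by fun_prop
  have hKabs : ∀ w, |K w| ≤ C := fun w => by rw [abs_of_nonneg (hK.nonneg w)]; exact hKC w
  have hprob : IsProbabilityMeasure ν := by
    rw [← hlaw 0]
    exact Measure.isProbabilityMeasure_map (hZ 0).aemeasurable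
  have hstoch : IsBigOP P (fun n ω => 1 / b n ^ d *
      (1 / n * ∑ i ∈ Finset.range n, K ((b n)⁻¹ • (p - Z i ω)) - m n))
      (fun n => 1 / √(n * b n ^ d)) := by
    -- From `K ^ 2 ≤ C * K` the second moment is at most `C * m n`, and the bias bound with `b n <
    -- 1` gives `m n ≤ b n ^ d * (φ p + M)`.
    refine isBigOP_of_integral_sq_le (C := C * (φ p + M)) (by positivity) ?_ ?_ ?_
    · filter_upwards [hb, hn1] with n hbn hn
      have : (0 : ℝ) < n := by positivity
      positivity
    · filter_upwards [hn1] with n hn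
      simp_rw [mul_pow]
      exact (integral_sq_average_sub_le hZ hind hlaw (hKnm n) (fun z => hKabs _) hn).1.const_mul _
    · filter_upwards [hb, hbδ, hn1] with n hbn hbδn hn
      have hn0 : (0 : ℝ) < n := by positivity
      rw [lt_min_iff] at hbδn
      have hbd : 0 < b n ^ d := by positivity
      have hmn : m n ≤ b n ^ d * (φ p + M) := by
        have h1 := (abs_le.1 (hbias (b n) hbn hbδn.1)).2
        have h2 : M * b n ^ d * b n ^ 2 ≤ M * b n ^ d * 1 := by
          gcongr
          exact pow_le_one₀ hbn.le hbδn.2.le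
        simp only [hm]
        linarith
      have hK2 : ∫ z, K ((b n)⁻¹ • (p - z)) ^ 2 ∂ν ≤ C * m n := by
        rw [hm, ← integral_const_mul]
        refine integral_mono_of_nonneg (ae_of_all _ fun z => sq_nonneg _) ?_
          (ae_of_all _ fun z => ?_)
        · exact (Integrable.of_bound (hKnm n).aestronglyMeasurable C
            (ae_of_all _ fun z => hKabs _)).const_mul C
        · change _ ^ 2 ≤ _
          rw [sq]
          exact mul_le_mul_of_nonneg_right (hKC _) (hK.nonneg _)
      simp_rw [mul_pow]
      rw [integral_const_mul]
      calc (1 / b n ^ d) ^ 2 * _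
          ≤ (1 / b n ^ d) ^ 2 * (1 / n * (C * (b n ^ d * (φ p + M)))) := by
            gcongr
            refine (integral_sq_average_sub_le hZ hind hlaw (hKnm n)
              (fun z => hKabs _) hn).2.trans ?_
            gcongr
            exact hK2.trans (by gcongr)
        _ = C * (φ p + M) * (1 / √(n * b n ^ d)) ^ 2 := by
            rw [div_pow, div_pow, Real.sq_sqrt (by positivity)]
            field_simp
  have hdet : IsBigOP P (fun n (_ : Ω) => 1 / b n ^ d * m n - φ p) (fun n => b n ^ 2) := by
    refine IsBigOP.of_abs_le hM ?_
    filter_upwards [hb, hbδ] with n hbn hbδn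
    rw [lt_min_iff] at hbδn
    have hbd : 0 < b n ^ d := by positivity
    have h1 := hbias (b n) hbn hbδn.1
    have h2 : 1 / b n ^ d * m n - φ p = 1 / b n ^ d * (m n - b n ^ d * φ p) := by field_simp
    rw [h2, abs_mul, abs_of_pos (by positivity)]
    calc _ ≤ 1 / b n ^ d * (M * b n ^ d * b n ^ 2) := by gcongr
      _ = _ := by field_simp
  have hsum := hstoch.add hdet (Eventually.of_forall fun n => by positivity)
    (Eventually.of_forall fun n => by positivity)
  convert hsum using 3 with n ω
  rw [one_div (_ * _), mul_inv]
  ring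

end Kernel

theorem tendsto_measure_union_zero {Ω : Type*} [MeasurableSpace Ω] {P : Measure Ω}
    {A B : ℕ → Set Ω} (hA : Tendsto (fun n => P (A n)) atTop (𝓝 0))
    (hB : Tendsto (fun n => P (B n)) atTop (𝓝 0)) :
    Tendsto (fun n => P (A n ∪ B n)) atTop (𝓝 0) :=
  tendsto_of_tendsto_of_tendsto_of_le_of_le tendsto_const_nhds
    (by simpa using hA.add hB) (fun _ => zero_le) fun _ => measure_union_le _ _

/-! ### Second moments of degenerate sums -/

section Degenerate

variable {Ω : Type*} [MeasurableSpace Ω] {P : Measure Ω} [IsProbabilityMeasure P]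
  {S : Type*} [MeasurableSpace S] {ν : Measure S} [IsProbabilityMeasure ν] {Z : ℕ → Ω → S}

/-- The terms of a degenerate statistic are conditionally uncorrelated. -/
theorem integral_indicator_mul_mul_eq_zero (hZ : ∀ i, Measurable (Z i)) (hind : iIndepFun Z P)
    (hlaw : ∀ i, P.map (Z i) = ν) {q : S → S → ℝ} (hq : Measurable (Function.uncurry q)) {C : ℝ}
    (hC : ∀ z w, |q z w| ≤ C) (hmean : ∀ z, ∫ w, q z w ∂ν = 0) {B : Set S}
    (hB : MeasurableSet B) {i j k : ℕ} (hik : i ≠ k) (hjk : j ≠ k) :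
    ∫ ω, B.indicator (fun _ => (1 : ℝ)) (Z i ω) * (q (Z i ω) (Z j ω) * q (Z i ω) (Z k ω)) ∂P
      = 0 := by
  set H : (S × S) × S → ℝ := fun u =>
    B.indicator (fun _ => (1 : ℝ)) u.1.1 * (q u.1.1 u.1.2 * q u.1.1 u.2) with hH
  have hBm : Measurable (B.indicator fun _ => (1 : ℝ)) := measurable_const.indicator hB
  have hHm : Measurable H := by
    refine (hBm.comp (measurable_fst.comp measurable_fst)).mul (Measurable.mul ?_ ?_)
    · exact hq.comp measurable_fst
    · exact hq.comp ((measurable_fst.comp measurable_fst).prodMk measurable_snd)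
  have hHb : ∀ u, ‖H u‖ ≤ 1 * (C * C) := by
    intro u
    rw [hH, norm_mul, norm_mul]
    have h0 : 0 ≤ C := (abs_nonneg _).trans (hC u.1.1 u.2)
    refine mul_le_mul ?_ (mul_le_mul (hC _ _) (hC _ _) (norm_nonneg _) h0) (by positivity)
      zero_le_one
    simp only [indicator]
    split_ifs <;> simp
  -- `Z k` is independent of the pair `(Z i, Z j)`, even when `i = j`; by Fubini, integrating it out
  -- first gives zero.
  have hprod := (indepFun_iff_map_prod_eq_prod_map_map
    ((hZ i).prodMk (hZ j)).aemeasurable (hZ k).aemeasurable).1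
    (hind.indepFun_prodMk hZ i j k hik hjk)
  have hprob : IsProbabilityMeasure (P.map fun ω => (Z i ω, Z j ω)) :=
    Measure.isProbabilityMeasure_map ((hZ i).prodMk (hZ j)).aemeasurable
  calc _ = ∫ u, H u ∂(P.map fun ω => ((Z i ω, Z j ω), Z k ω)) := by
        rw [integral_map (((hZ i).prodMk (hZ j)).prodMk (hZ k)).aemeasurable
          hHm.aestronglyMeasurable]
    _ = 0 := by
        rw [hprod, hlaw k, integral_prod _
          (Integrable.of_bound hHm.aestronglyMeasurable _ (ae_of_all _ hHb))]
        simp only [hH, integral_const_mul, hmean, mul_zero, integral_zero]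

theorem integral_indicator_mul_sq_sum_le (hZ : ∀ i, Measurable (Z i)) (hind : iIndepFun Z P)
    (hlaw : ∀ i, P.map (Z i) = ν) {q : S → S → ℝ} (hq : Measurable (Function.uncurry q)) {C : ℝ}
    (hC : ∀ z w, |q z w| ≤ C) (hmean : ∀ z, ∫ w, q z w ∂ν = 0) {B : Set S}
    (hB : MeasurableSet B) (i n : ℕ) :
    Integrable (fun ω => B.indicator (fun _ => (1 : ℝ)) (Z i ω) *
        (∑ j ∈ Finset.range n, q (Z i ω) (Z j ω)) ^ 2) P ∧
      ∫ ω, B.indicator (fun _ => (1 : ℝ)) (Z i ω) *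
        (∑ j ∈ Finset.range n, q (Z i ω) (Z j ω)) ^ 2 ∂P ≤ n * (C ^ 2 * ν.real B) := by
  have hBm : Measurable (B.indicator fun _ => (1 : ℝ)) := measurable_const.indicator hB
  have hqm : ∀ j, Measurable fun ω => q (Z i ω) (Z j ω) := fun j =>
    hq.comp ((hZ i).prodMk (hZ j))
  have hint : ∀ j k, Integrable (fun ω => B.indicator (fun _ => (1 : ℝ)) (Z i ω) *
      (q (Z i ω) (Z j ω) * q (Z i ω) (Z k ω))) P := by
    intro j k
    refine Integrable.of_bound ((hBm.comp (hZ i)).mul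
      ((hqm j).mul (hqm k))).aestronglyMeasurable (1 * (C * C)) (ae_of_all _ fun ω => ?_)
    rw [norm_mul, norm_mul]
    have h0 : 0 ≤ C := (abs_nonneg _).trans (hC (Z i ω) (Z j ω))
    refine mul_le_mul ?_ (mul_le_mul (hC _ _) (hC _ _) (norm_nonneg _) h0) (by positivity)
      zero_le_one
    simp only [indicator]
    split_ifs <;> simp
  have hexp : ∀ ω, B.indicator (fun _ => (1 : ℝ)) (Z i ω) *
      (∑ j ∈ Finset.range n, q (Z i ω) (Z j ω)) ^ 2
      = ∑ j ∈ Finset.range n, ∑ k ∈ Finset.range n, B.indicator (fun _ => (1 : ℝ)) (Z i ω) *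
        (q (Z i ω) (Z j ω) * q (Z i ω) (Z k ω)) := by
    intro ω
    rw [sq, Finset.sum_mul_sum, Finset.mul_sum]
    simp_rw [Finset.mul_sum]
  simp_rw [hexp]
  refine ⟨integrable_finsetSum _ fun j _ => integrable_finsetSum _ fun k _ => hint j k, ?_⟩
  rw [integral_finsetSum _ fun j _ => integrable_finsetSum _ fun k _ => hint j k]
  have hrow : ∀ j ∈ Finset.range n, ∫ ω, ∑ k ∈ Finset.range n,
      B.indicator (fun _ => (1 : ℝ)) (Z i ω) * (q (Z i ω) (Z j ω) * q (Z i ω) (Z k ω)) ∂P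
      ≤ C ^ 2 * ν.real B := by
    intro j hj
    -- Only the diagonal `k = j` survives, so the square of the sum costs `n` terms instead of `n ^
    -- 2`.
    rw [integral_finsetSum _ fun k _ => hint j k, Finset.sum_eq_single_of_mem j hj]
    · have h1 : ∫ ω, B.indicator (fun _ => (1 : ℝ)) (Z i ω) ∂P = ν.real B := by
        rw [← hlaw i, ← integral_map (hZ i).aemeasurable hBm.aestronglyMeasurable,
          integral_indicator_const _ hB]
        simp
      have hi : Integrable (fun ω => B.indicator (fun _ => (1 : ℝ)) (Z i ω)) P :=
        (integrable_const (1 : ℝ)).indicator (hZ i hB)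
      rw [← h1, ← integral_const_mul]
      refine integral_mono (hint j j) (hi.const_mul _) fun ω => ?_
      change _ * _ ≤ _ * _
      rw [mul_comm, ← sq, ← sq_abs]
      exact mul_le_mul_of_nonneg_right (pow_le_pow_left₀ (abs_nonneg _) (hC _ _) 2)
        (indicator_nonneg (fun _ _ => zero_le_one) _)
    · intro k _ hkj
      by_cases hik : i = k
      -- Here `j` differs from both other indices, so it is the variable to integrate out.
      · subst hik
        simp_rw [mul_comm (q _ (Z j _))]
        exact integral_indicator_mul_mul_eq_zero hZ hind hlaw hq hC hmean hB hkj hkj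
      · exact integral_indicator_mul_mul_eq_zero hZ hind hlaw hq hC hmean hB hik hkj.symm
  refine (Finset.sum_le_sum hrow).trans ?_
  simp

end Degenerate

/-! ### Empirical distribution functions -/

section Ecdf

theorem monotone_ecdf (n : ℕ) (X : ℕ → ℝ) : Monotone (ecdf n X) := by
  intro s t hst
  unfold ecdf
  gcongr

/-- If an increasing function is uniformly close to `F` at three points, points that are far
from `x` for `F` remain far from `x`. -/
theorem lt_abs_sub_of_lt_abs_sub {F H : ℝ → ℝ} (hF : Monotone F) (hH : Monotone H)
    {x s₁ s₂ t s : ℝ} (h₁ : F s₁ = F x - 2 * t) (h₂ : F s₂ = F x + 2 * t)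
    (hx : |H x - F x| < t / 2) (hs₁ : |H s₁ - F s₁| < t / 2) (hs₂ : |H s₂ - F s₂| < t / 2)
    (hs : 2 * t < |F x - F s|) : t < |H x - H s| := by
  rw [abs_lt] at hx hs₁ hs₂
  rcases lt_abs.1 hs with h | h
  · have hlt : s < s₁ := hF.reflect_lt (by linarith)
    have := hH hlt.le
    exact lt_abs.2 (Or.inl (by linarith))
  · have hlt : s₂ < s := hF.reflect_lt (by linarith)
    have := hH hlt.le
    exact lt_abs.2 (Or.inr (by linarith))

variable {Ω : Type*} [MeasurableSpace Ω] {P : Measure Ω} [IsProbabilityMeasure P]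
  {S : Type*} [MeasurableSpace S] {ν : Measure S} {Z : ℕ → Ω → S} {T : S → ℝ} {F : ℝ → ℝ}

theorem integral_indicator_Iic_comp (hT : Measurable T) (hF : ∀ s, ν.real (T ⁻¹' Iic s) = F s)
    (s : ℝ) : ∫ w, (Iic s).indicator (fun _ => (1 : ℝ)) (T w) ∂ν = F s := by
  rw [← hF s, ← integral_indicator_one (hT measurableSet_Iic)]
  rfl

variable [IsProbabilityMeasure ν]

/-- Chebyshev's inequality with variance at most `1 / n`. The point `s n` may move with `n`, as
needed for quantiles at levels approaching `F x`. -/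
theorem tendsto_measure_ecdf_dev (hZ : ∀ i, Measurable (Z i)) (hind : iIndepFun Z P)
    (hlaw : ∀ i, P.map (Z i) = ν) (hT : Measurable T) (hF : ∀ s, ν.real (T ⁻¹' Iic s) = F s)
    (s t : ℕ → ℝ) (ht : ∀ᶠ n in atTop, 0 < t n)
    (hnt : Tendsto (fun n : ℕ => (n : ℝ) * t n ^ 2) atTop atTop) :
    Tendsto (fun n => P {ω | t n ≤ |ecdf n (fun i => T (Z i ω)) (s n) - F (s n)|})
      atTop (𝓝 0) := by
  have hlim : Tendsto (fun n : ℕ => ENNReal.ofReal (1 / ((n : ℝ) * t n ^ 2))) atTop (𝓝 0) := by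
    rw [← ENNReal.ofReal_zero]
    exact ENNReal.tendsto_ofReal (by simpa only [one_div, Function.comp_def] using tendsto_inv_atTop_zero.comp hnt)
  refine tendsto_of_tendsto_of_tendsto_of_le_of_le' tendsto_const_nhds hlim
    (Eventually.of_forall fun _ => zero_le) ?_
  filter_upwards [ht, eventually_ge_atTop 1] with n htn hn
  have hn0 : (0 : ℝ) < n := by positivity
  set q : S → ℝ := fun w => (Iic (s n)).indicator (fun _ => (1 : ℝ)) (T w) with hq
  have hqm : Measurable q := (measurable_const.indicator measurableSet_Iic).comp hT
  have hq1 : ∀ w, |q w| ≤ 1 := fun w => by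
    simp only [hq, indicator]
    split_ifs <;> simp
  obtain ⟨hi, hle⟩ := integral_sq_average_sub_le hZ hind hlaw hqm hq1 hn
  rw [integral_indicator_Iic_comp hT hF] at hi hle
  have hq2 : ∫ z, q z ^ 2 ∂ν ≤ 1 := by
    refine (integral_mono_of_nonneg (ae_of_all _ fun z => sq_nonneg _) (integrable_const 1)
      (ae_of_all _ fun z => ?_)).trans (by simp)
    change q z ^ 2 ≤ 1
    rw [← sq_abs]
    exact pow_le_one₀ (abs_nonneg _) (hq1 z)
  have key := mul_meas_ge_le_integral_of_nonneg (ae_of_all P fun ω => sq_nonneg _) hi (t n ^ 2)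
  calc P {ω | t n ≤ |ecdf n (fun i => T (Z i ω)) (s n) - F (s n)|}
      ≤ P {ω | t n ^ 2 ≤ (1 / n * ∑ i ∈ Finset.range n, q (Z i ω) - F (s n)) ^ 2} := by
        refine measure_mono fun ω hω => ?_
        simp only [mem_ofPred_eq] at hω ⊢
        rw [← sq_abs (_ - _)]
        exact pow_le_pow_left₀ htn.le hω 2
    _ = ENNReal.ofReal
        (P.real {ω | t n ^ 2 ≤ (1 / n * ∑ i ∈ Finset.range n, q (Z i ω) - F (s n)) ^ 2}) := by
        rw [ofReal_measureReal]
    _ ≤ ENNReal.ofReal (1 / ((n : ℝ) * t n ^ 2)) := by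
        refine ENNReal.ofReal_le_ofReal ?_
        rw [le_div_iff₀ (by positivity)]
        have h1 := key.trans (hle.trans (mul_le_mul_of_nonneg_left hq2 (by positivity)))
        have h2 := mul_le_mul_of_nonneg_left h1 hn0.le
        have h3 : (n : ℝ) * (1 / n * 1) = 1 := by field_simp
        linarith

/-- The mean square oscillation of the empirical process between `x` and a sample point. -/
theorem integral_indicator_mul_ecdf_osc_sq_le (hZ : ∀ i, Measurable (Z i))
    (hind : iIndepFun Z P) (hlaw : ∀ i, P.map (Z i) = ν) (hT : Measurable T)
    (hF : ∀ s, ν.real (T ⁻¹' Iic s) = F s) (hFmono : Monotone F) (x : ℝ) {B : Set S}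
    (hB : MeasurableSet B) (i : ℕ) {n : ℕ} (hn : 1 ≤ n) :
    Integrable (fun ω => B.indicator (fun _ => (1 : ℝ)) (Z i ω) *
        ((ecdf n (fun j => T (Z j ω)) x - ecdf n (fun j => T (Z j ω)) (T (Z i ω)))
          - (F x - F (T (Z i ω)))) ^ 2) P ∧
      ∫ ω, B.indicator (fun _ => (1 : ℝ)) (Z i ω) *
        ((ecdf n (fun j => T (Z j ω)) x - ecdf n (fun j => T (Z j ω)) (T (Z i ω)))
          - (F x - F (T (Z i ω)))) ^ 2 ∂P ≤ 4 * ν.real B / n := by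
  have hn0 : (0 : ℝ) < n := by positivity
  set I : ℝ → ℝ → ℝ := fun s t => (Iic s).indicator (fun _ => (1 : ℝ)) t with hI
  have hI01 : ∀ s t, 0 ≤ I s t ∧ I s t ≤ 1 := fun s t => by
    simp only [hI, indicator]
    split_ifs <;> simp
  have hF01 : ∀ s, 0 ≤ F s ∧ F s ≤ 1 := fun s => by
    rw [← hF s]
    exact ⟨measureReal_nonneg, measureReal_le_one⟩
  have hIm : Measurable (Function.uncurry I) := by
    have : Function.uncurry I = ({u : ℝ × ℝ | u.2 ≤ u.1}).indicator fun _ => (1 : ℝ) := by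
      ext u
      simp [hI, indicator, Function.uncurry]
    rw [this]
    exact measurable_const.indicator (measurableSet_le measurable_snd measurable_fst)
  have hIs : ∀ s, Measurable (I s) := fun s => measurable_const.indicator measurableSet_Iic
  -- Centred in `w` for each fixed `z`, so the oscillation at `Z i` is an average of a degenerate
  -- kernel. The bound `|q| ≤ 2` is the source of the constant `4`.
  set q : S → S → ℝ := fun z w => (I x (T w) - I (T z) (T w)) - (F x - F (T z)) with hq
  have hqm : Measurable (Function.uncurry q) := by
    have h1 : Measurable fun u : S × S => I x (T u.2) := (hIs x).comp (hT.comp measurable_snd)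
    have h2 : Measurable fun u : S × S => I (T u.1) (T u.2) :=
      hIm.comp ((hT.comp measurable_fst).prodMk (hT.comp measurable_snd))
    have h3 : Measurable fun u : S × S => F (T u.1) :=
      hFmono.measurable.comp (hT.comp measurable_fst)
    exact (h1.sub h2).sub (measurable_const.sub h3)
  have hq2 : ∀ z w, |q z w| ≤ 2 := fun z w => by
    have := hI01 x (T w)
    have := hI01 (T z) (T w)
    have := hF01 x
    have := hF01 (T z)
    rw [abs_le]
    constructor <;> simp only [hq] <;> linarith
  have hIi : ∀ s, Integrable (fun w => I s (T w)) ν := fun s =>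
    Integrable.of_bound ((hIs s).comp hT).aestronglyMeasurable 1 (ae_of_all _ fun w => by
      rw [Real.norm_of_nonneg (hI01 _ _).1]
      exact (hI01 _ _).2)
  have hmean : ∀ z, ∫ w, q z w ∂ν = 0 := fun z => by
    simp only [hq]
    have hsub : Integrable (fun w => I x (T w) - I (T z) (T w)) ν := (hIi _).sub (hIi _)
    rw [integral_sub hsub (integrable_const _), integral_sub (hIi _) (hIi _),
      integral_indicator_Iic_comp hT hF, integral_indicator_Iic_comp hT hF]
    simp
  obtain ⟨hint, hle⟩ := integral_indicator_mul_sq_sum_le hZ hind hlaw hqm hq2 hmean hB i n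
  have hrw : ∀ ω, B.indicator (fun _ => (1 : ℝ)) (Z i ω) *
        ((ecdf n (fun j => T (Z j ω)) x - ecdf n (fun j => T (Z j ω)) (T (Z i ω)))
          - (F x - F (T (Z i ω)))) ^ 2
      = (1 / n) ^ 2 * (B.indicator (fun _ => (1 : ℝ)) (Z i ω) *
        (∑ j ∈ Finset.range n, q (Z i ω) (Z j ω)) ^ 2) := by
    intro ω
    have : (ecdf n (fun j => T (Z j ω)) x - ecdf n (fun j => T (Z j ω)) (T (Z i ω)))
          - (F x - F (T (Z i ω))) = 1 / n * ∑ j ∈ Finset.range n, q (Z i ω) (Z j ω) := by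
      simp only [hq, ecdf, Finset.sum_sub_distrib, Finset.sum_const, Finset.card_range,
        nsmul_eq_mul, hI]
      field_simp
    rw [this]
    ring
  simp_rw [hrw]
  refine ⟨hint.const_mul _, ?_⟩
  rw [integral_const_mul]
  refine (mul_le_mul_of_nonneg_left hle (by positivity)).trans (le_of_eq ?_)
  field_simp
  ring

end Ecdf

/-! ### Replacing `F`, `G` by their empirical versions -/

section Replacement

/-- Comparison of two kernel values at standardized increments. -/
theorem abs_kernel_sub_le {K : ℝ × ℝ → ℝ} {L R a : ℝ} (hL : 0 ≤ L)
    (hlip : ∀ z w, |K z - K w| ≤ L * ‖z - w‖)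
    (hR : 0 < R) (ha : 0 < a) (hsupp : ∀ z, K z ≠ 0 → ‖z‖ ≤ R) {u v u' v' : ℝ}
    (hu : 2 * (R * a) < |u| → R * a < |u'|) (hv : 2 * (R * a) < |v| → R * a < |v'|) :
    |K (u' / a, v' / a) - K (u / a, v / a)|
      ≤ {w : ℝ × ℝ | |w.1| ≤ 2 * (R * a) ∧ |w.2| ≤ 2 * (R * a)}.indicator
        (fun _ => L / a * (|u' - u| + |v' - v|)) (u, v) := by
  have hzero : ∀ s t : ℝ, (R * a < |s| ∨ R * a < |t|) → K (s / a, t / a) = 0 := by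
    intro s t hst
    by_contra hne
    have h := hsupp _ hne
    rw [Prod.norm_mk, max_le_iff, Real.norm_eq_abs, Real.norm_eq_abs, abs_div, abs_div,
      abs_of_pos ha, div_le_iff₀ ha, div_le_iff₀ ha] at h
    rcases hst with h' | h' <;> linarith [h.1, h.2]
  have hRa : 0 < R * a := by positivity
  -- Inside the box the Lipschitz bound applies; outside, some coordinate exceeds `R * a` before and
  -- after replacement, so both kernel values vanish.
  by_cases hmem : |u| ≤ 2 * (R * a) ∧ |v| ≤ 2 * (R * a)
  · rw [indicator_of_mem (by exact hmem)]
    refine (hlip _ _).trans ?_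
    rw [Prod.mk_sub_mk, Prod.norm_mk, ← sub_div, ← sub_div, Real.norm_eq_abs, Real.norm_eq_abs,
      abs_div, abs_div, abs_of_pos ha, div_mul_eq_mul_div, mul_div_assoc]
    gcongr
    rw [add_div]
    exact max_le_add_of_nonneg (by positivity) (by positivity)
  · rw [indicator_of_notMem (by exact hmem)]
    have hor : 2 * (R * a) < |u| ∨ 2 * (R * a) < |v| := by
      by_contra! h
      exact hmem h
    rw [hzero u' v' (hor.imp hu hv), hzero u v (hor.imp (by intro; linarith) (by intro; linarith))]
    simp

variable {Ω : Type*} [MeasurableSpace Ω] {P : Measure Ω} [IsProbabilityMeasure P]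
  {μ : Measure (ℝ × ℝ)} [IsProbabilityMeasure μ] {X Y : ℕ → Ω → ℝ}

theorem measureReal_preimage_fst_Iic (s : ℝ) : μ.real (Prod.fst ⁻¹' Iic s) = cdfX μ s := by
  rw [cdfX, cdf_eq_real, Measure.fst, map_measureReal_apply measurable_fst measurableSet_Iic]

theorem measureReal_preimage_snd_Iic (s : ℝ) : μ.real (Prod.snd ⁻¹' Iic s) = cdfY μ s := by
  rw [cdfY, cdf_eq_real, Measure.snd, map_measureReal_apply measurable_snd measurableSet_Iic]

theorem exists_cdf_eq {ρ : Measure ℝ} (hρ : Continuous (cdf ρ)) {v : ℝ}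
    (hv : v ∈ Ioo (0 : ℝ) 1) : ∃ s, cdf ρ s = v := by
  obtain ⟨s, hs⟩ := ((tendsto_cdf_atBot ρ).eventually (Iio_mem_nhds hv.1)).exists
  obtain ⟨t, ht⟩ := ((tendsto_cdf_atTop ρ).eventually (Ioi_mem_nhds hv.2)).exists
  exact mem_range_of_exists_le_of_exists_ge hρ ⟨s, le_of_lt hs⟩ ⟨t, le_of_lt ht⟩

/-- Strictness keeps `(F(x), G(y))` off the boundary of the unit square, so there is no boundary
bias. -/
theorem cdf_mem_Ioo {ρ : Measure ℝ} (hρ : StrictMono (cdf ρ)) (x : ℝ) :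
    cdf ρ x ∈ Ioo (0 : ℝ) 1 :=
  ⟨(cdf_nonneg ρ (x - 1)).trans_lt (hρ (by linarith)),
    (hρ (by linarith : x < x + 1)).trans_le (cdf_le_one ρ _)⟩

/-- Outside of events of vanishing probability, points whose `F`-distance to `x` exceeds `2 R a`
are at distance greater than `R a` for the empirical distribution function. -/
theorem exists_ecdf_separation {S : Type*} [MeasurableSpace S] {ν : Measure S}
    [IsProbabilityMeasure ν] {Z : ℕ → Ω → S} {T : S → ℝ} {ρ : Measure ℝ}
    (hZ : ∀ i, Measurable (Z i)) (hind : iIndepFun Z P) (hlaw : ∀ i, P.map (Z i) = ν)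
    (hT : Measurable T) (hF : ∀ s, ν.real (T ⁻¹' Iic s) = cdf ρ s)
    (hmono : StrictMono (cdf ρ)) (hcont : Continuous (cdf ρ)) (x : ℝ) {R : ℝ} (hR : 0 < R)
    {a : ℕ → ℝ} (ha : ∀ᶠ n in atTop, 0 < a n) (ha0 : Tendsto a atTop (𝓝 0))
    (hna : Tendsto (fun n : ℕ => (n : ℝ) * a n ^ 2) atTop atTop) :
    ∃ A : ℕ → Set Ω, Tendsto (fun n => P (A n)) atTop (𝓝 0) ∧
      ∀ᶠ n in atTop, ∀ ω ∉ A n, ∀ s, 2 * (R * a n) < |cdf ρ x - cdf ρ s| →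
        R * a n < |ecdf n (fun i => T (Z i ω)) x - ecdf n (fun i => T (Z i ω)) s| := by
  have hx := cdf_mem_Ioo hmono x
  choose! σ hσ using fun v (hv : v ∈ Ioo (0 : ℝ) 1) => exists_cdf_eq hcont hv
  have ht : ∀ᶠ n in atTop, 0 < R * a n / 2 := ha.mono fun n hn => by positivity
  have hnt : Tendsto (fun n : ℕ => (n : ℝ) * (R * a n / 2) ^ 2) atTop atTop := by
    refine (hna.const_mul_atTop (show 0 < R ^ 2 / 4 by positivity)).congr fun n => ?_
    ring
  have hdev := fun s : ℕ → ℝ => tendsto_measure_ecdf_dev hZ hind hlaw hT hF s _ ht hnt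
  refine ⟨_, tendsto_measure_union_zero (hdev fun _ => x) (tendsto_measure_union_zero
    (hdev fun n => σ (cdf ρ x - 2 * (R * a n))) (hdev fun n => σ (cdf ρ x + 2 * (R * a n)))), ?_⟩
  have hlim₁ : Tendsto (fun n => cdf ρ x - 2 * (R * a n)) atTop (𝓝 (cdf ρ x)) := by
    simpa using tendsto_const_nhds.sub ((ha0.const_mul R).const_mul 2)
  have hlim₂ : Tendsto (fun n => cdf ρ x + 2 * (R * a n)) atTop (𝓝 (cdf ρ x)) := by
    simpa using tendsto_const_nhds.add ((ha0.const_mul R).const_mul 2)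
  filter_upwards [hlim₁.eventually (isOpen_Ioo.mem_nhds hx),
    hlim₂.eventually (isOpen_Ioo.mem_nhds hx)] with n h₁ h₂ ω hω s hs
  simp only [mem_union, mem_ofPred_eq, not_or, not_le] at hω
  exact lt_abs_sub_of_lt_abs_sub hmono.monotone (monotone_ecdf n _) (hσ _ h₁) (hσ _ h₂)
    hω.1 hω.2.1 hω.2.2 hs

/-- A weighted AM-GM inequality in place of Cauchy-Schwarz: first moments of oscillations of size `1
/ √n` reduce to second moments without loss of rate. -/
theorem abs_le_sqrt_mul_sq_add {N : ℝ} (hN : 0 < N) (d : ℝ) : |d| ≤ √N * d ^ 2 + 1 / √N := by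
  have hs : 0 < √N := Real.sqrt_pos.2 hN
  have h : √N * d ^ 2 + 1 / √N - 2 * |d| = (√N * |d| - 1) ^ 2 / √N := by
    rw [← sq_abs d]
    field_simp
    ring
  have h2 : 0 ≤ (√N * |d| - 1) ^ 2 / √N := by positivity
  linarith [abs_nonneg d]

/-- Replacing the distribution functions by their empirical versions in the copula density
estimator has an effect of order `1 / √(n a²)`. -/
theorem isBigOP_copulaEstimator_sub (hX : ∀ i, Measurable (X i)) (hY : ∀ i, Measurable (Y i))
    (hind : iIndepFun (fun i ω => (X i ω, Y i ω)) P)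
    (hlaw : ∀ i, P.map (fun ω => (X i ω, Y i ω)) = μ)
    (hF : StrictMono (cdfX μ)) (hFc : Continuous (cdfX μ))
    (hG : StrictMono (cdfY μ)) (hGc : Continuous (cdfY μ)) (x y : ℝ)
    {K : ℝ × ℝ → ℝ} {L R : ℝ} (hL : 0 ≤ L) (hlip : ∀ z w, |K z - K w| ≤ L * ‖z - w‖)
    (hR : 0 < R) (hsupp : ∀ z, K z ≠ 0 → ‖z‖ ≤ R) {C δ : ℝ} (hC : 0 < C) (hδ : 0 < δ)
    (hbox : ∀ t, 0 < t → t < δ →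
      μ.real {p | |cdfX μ x - cdfX μ p.1| ≤ t ∧ |cdfY μ y - cdfY μ p.2| ≤ t} ≤ C * t ^ 2)
    {a : ℕ → ℝ} (ha : ∀ᶠ n in atTop, 0 < a n) (ha0 : Tendsto a atTop (𝓝 0))
    (hna : Tendsto (fun n : ℕ => (n : ℝ) * a n ^ 2) atTop atTop) :
    IsBigOP P (fun n ω => copulaEstimator K n (a n) (fun i => X i ω) (fun i => Y i ω)
        (ecdf n (fun i => X i ω) x) (ecdf n (fun i => Y i ω) y)
      - 1 / (n * a n ^ 2) * ∑ i ∈ Finset.range n,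
        K ((cdfX μ x - cdfX μ (X i ω)) / a n, (cdfY μ y - cdfY μ (Y i ω)) / a n))
      (fun n => 1 / √(n * a n ^ 2)) := by
  set Z : ℕ → Ω → ℝ × ℝ := fun i ω => (X i ω, Y i ω) with hZdef
  have hZ : ∀ i, Measurable (Z i) := fun i => (hX i).prodMk (hY i)
  obtain ⟨A₁, hA₁, hsep₁⟩ := exists_ecdf_separation hZ hind hlaw measurable_fst
    measureReal_preimage_fst_Iic hF hFc x hR ha ha0 hna
  obtain ⟨A₂, hA₂, hsep₂⟩ := exists_ecdf_separation hZ hind hlaw measurable_snd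
    measureReal_preimage_snd_Iic hG hGc y hR ha ha0 hna
  set B : ℕ → Set (ℝ × ℝ) := fun n =>
    {p | |cdfX μ x - cdfX μ p.1| ≤ 2 * (R * a n) ∧ |cdfY μ y - cdfY μ p.2| ≤ 2 * (R * a n)}
    with hBdef
  have hB : ∀ n, MeasurableSet (B n) := fun n => by
    have h₁ : Measurable fun p : ℝ × ℝ => |cdfX μ x - cdfX μ p.1| := by
      have := hFc.measurable
      fun_prop
    have h₂ : Measurable fun p : ℝ × ℝ => |cdfY μ y - cdfY μ p.2| := by
      have := hGc.measurable
      fun_prop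
    exact (measurableSet_le h₁ measurable_const).inter (measurableSet_le h₂ measurable_const)
  set dX : ℕ → ℕ → Ω → ℝ := fun n i ω =>
    (ecdf n (fun j => X j ω) x - ecdf n (fun j => X j ω) (X i ω))
      - (cdfX μ x - cdfX μ (X i ω)) with hdX
  set dY : ℕ → ℕ → Ω → ℝ := fun n i ω =>
    (ecdf n (fun j => Y j ω) y - ecdf n (fun j => Y j ω) (Y i ω))
      - (cdfY μ y - cdfY μ (Y i ω)) with hdY
  -- The dominating variable: `1 / (n a²)` from the estimator, `L / a` from the Lipschitz bound, and
  -- AM-GM applied to both oscillations on the box. Its mean is computable.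
  set W : ℕ → Ω → ℝ := fun n ω => L / (n * a n ^ 3) * ∑ i ∈ Finset.range n,
    (√n * ((B n).indicator (fun _ => (1 : ℝ)) (Z i ω) * dX n i ω ^ 2)
      + √n * ((B n).indicator (fun _ => (1 : ℝ)) (Z i ω) * dY n i ω ^ 2)
      + 2 / √n * (B n).indicator (fun _ => (1 : ℝ)) (Z i ω)) with hW
  have hI0 : ∀ n p, 0 ≤ (B n).indicator (fun _ => (1 : ℝ)) p := fun n p =>
    indicator_nonneg (fun _ _ => zero_le_one) _
  have hWnn : ∀ᶠ n in atTop, ∀ ω, 0 ≤ W n ω := by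
    filter_upwards [ha] with n han ω
    refine mul_nonneg (by positivity) (Finset.sum_nonneg fun i _ => ?_)
    have := hI0 n (Z i ω)
    positivity
  have hXosc := fun (n : ℕ) (hn : 1 ≤ n) (i : ℕ) => integral_indicator_mul_ecdf_osc_sq_le hZ hind
    hlaw measurable_fst measureReal_preimage_fst_Iic hF.monotone x (hB n) i hn
  have hYosc := fun (n : ℕ) (hn : 1 ≤ n) (i : ℕ) => integral_indicator_mul_ecdf_osc_sq_le hZ hind
    hlaw measurable_snd measureReal_preimage_snd_Iic hG.monotone y (hB n) i hn
  have hIi : ∀ n i, Integrable (fun ω => (B n).indicator (fun _ => (1 : ℝ)) (Z i ω)) P :=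
    fun n i => (integrable_const (1 : ℝ)).indicator (hZ i (hB n))
  have hIe : ∀ n i, ∫ ω, (B n).indicator (fun _ => (1 : ℝ)) (Z i ω) ∂P = μ.real (B n) := by
    intro n i
    rw [← hlaw i, ← integral_map (hZ i).aemeasurable
      (measurable_const.indicator (hB n)).aestronglyMeasurable, integral_indicator_const _ (hB n)]
    simp [hZdef]
  have hWi : IsBigOP P W (fun n => 1 / √(n * a n ^ 2)) := by
    -- Each summand has mean at most `(4 + 4 + 2) μ(B) / √n`, and `μ(B) ≤ 4 C R² a²`; the `+ 1`
    -- covers `L = 0`.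
    refine isBigOP_of_integral_le (C := 40 * C * R ^ 2 * L + 1) (by positivity) ?_ ?_ hWnn ?_
    · filter_upwards [ha, eventually_ge_atTop 1] with n han hn
      have : (0 : ℝ) < n := by positivity
      positivity
    · filter_upwards [eventually_ge_atTop 1] with n hn
      exact (integrable_finsetSum _ fun i _ => (((hXosc n hn i).1.const_mul _).add
        ((hYosc n hn i).1.const_mul _)).add ((hIi n i).const_mul _)).const_mul _
    · have hsmall : ∀ᶠ n in atTop, 2 * (R * a n) < δ := by
        have : Tendsto (fun n => 2 * (R * a n)) atTop (𝓝 0) := by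
          simpa using (ha0.const_mul R).const_mul 2
        exact this.eventually (Iio_mem_nhds hδ)
      filter_upwards [ha, eventually_ge_atTop 1, hsmall] with n han hn hsm
      have hn0 : (0 : ℝ) < n := by positivity
      have hs0 : 0 < √(n : ℝ) := Real.sqrt_pos.2 hn0
      have hss : √(n : ℝ) * √(n : ℝ) = n := Real.mul_self_sqrt hn0.le
      have hBn : μ.real (B n) ≤ C * (2 * (R * a n)) ^ 2 := hbox _ (by positivity) hsm
      have hterm : ∀ i, ∫ ω, (√n * ((B n).indicator (fun _ => (1 : ℝ)) (Z i ω) * dX n i ω ^ 2)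
          + √n * ((B n).indicator (fun _ => (1 : ℝ)) (Z i ω) * dY n i ω ^ 2)
          + 2 / √n * (B n).indicator (fun _ => (1 : ℝ)) (Z i ω)) ∂P
          ≤ 10 * μ.real (B n) / √n := by
        intro i
        have h12 : Integrable (fun ω =>
            √n * ((B n).indicator (fun _ => (1 : ℝ)) (Z i ω) * dX n i ω ^ 2)
            + √n * ((B n).indicator (fun _ => (1 : ℝ)) (Z i ω) * dY n i ω ^ 2)) P :=
          ((hXosc n hn i).1.const_mul _).add ((hYosc n hn i).1.const_mul _)
        rw [integral_add h12 ((hIi n i).const_mul _),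
          integral_add ((hXosc n hn i).1.const_mul _) ((hYosc n hn i).1.const_mul _),
          integral_const_mul, integral_const_mul, integral_const_mul, hIe]
        calc _ ≤ √n * (4 * μ.real (B n) / n) + √n * (4 * μ.real (B n) / n)
              + 2 / √n * μ.real (B n) := by
              gcongr
              · exact (hXosc n hn i).2
              · exact (hYosc n hn i).2
          _ = 10 * μ.real (B n) / √n := by
              have h : √(n : ℝ) * (4 * μ.real (B n) / n) = 4 * μ.real (B n) / √n := by
                rw [← mul_div_assoc, div_eq_div_iff hn0.ne' hs0.ne', mul_right_comm, hss]
                ring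
              rw [h]
              ring
      simp only [hW]
      rw [integral_const_mul, integral_finsetSum]
      · calc _ ≤ L / (n * a n ^ 3) * ∑ i ∈ Finset.range n, 10 * μ.real (B n) / √n := by
              gcongr with i
              exact hterm i
          _ = L / (n * a n ^ 3) * (n * (10 * μ.real (B n) / √n)) := by simp
          _ ≤ L / (n * a n ^ 3) * (n * (10 * (C * (2 * (R * a n)) ^ 2) / √n)) := by gcongr
          _ = 40 * C * R ^ 2 * L * (1 / √(n * a n ^ 2)) := by
              rw [Real.sqrt_mul hn0.le, Real.sqrt_sq han.le]
              field_simp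
              ring
          _ ≤ (40 * C * R ^ 2 * L + 1) * (1 / √(n * a n ^ 2)) := by
              gcongr
              linarith
      · intro i _
        exact (((hXosc n hn i).1.const_mul _).add
          ((hYosc n hn i).1.const_mul _)).add ((hIi n i).const_mul _)
  refine hWi.of_le_outside (tendsto_measure_union_zero hA₁ hA₂) ?_
  filter_upwards [ha, hsep₁, hsep₂, eventually_ge_atTop 1, hWnn] with n han h₁ h₂ hn hWn ω hω
  rw [mem_union, not_or] at hω
  have hn0 : (0 : ℝ) < n := by positivity
  rw [abs_of_nonneg (hWn ω), copulaEstimator, ← mul_sub, ← Finset.sum_sub_distrib, abs_mul,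
    abs_of_pos (by positivity)]
  calc _ ≤ 1 / (n * a n ^ 2) * ∑ i ∈ Finset.range n, L / a n *
        (√n * ((B n).indicator (fun _ => (1 : ℝ)) (Z i ω) * dX n i ω ^ 2)
      + √n * ((B n).indicator (fun _ => (1 : ℝ)) (Z i ω) * dY n i ω ^ 2)
      + 2 / √n * (B n).indicator (fun _ => (1 : ℝ)) (Z i ω)) := by
        gcongr
        refine (Finset.abs_sum_le_sum_abs _ _).trans (Finset.sum_le_sum fun i _ => ?_)
        refine (abs_kernel_sub_le hL hlip hR han hsupp (h₁ ω hω.1 (X i ω))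
          (h₂ ω hω.2 (Y i ω))).trans ?_
        by_cases hmem : Z i ω ∈ B n
        · rw [indicator_of_mem (by exact hmem), indicator_of_mem hmem]
          have e₁ := abs_le_sqrt_mul_sq_add hn0 (dX n i ω)
          have e₂ := abs_le_sqrt_mul_sq_add hn0 (dY n i ω)
          have e₃ : (2 : ℝ) / √n = 1 / √n + 1 / √n := by ring
          refine mul_le_mul_of_nonneg_left ?_ (by positivity)
          change |dX n i ω| + |dY n i ω| ≤ _
          linarith
        · rw [indicator_of_notMem (by exact hmem), indicator_of_notMem hmem]
          simp
    _ = W n ω := by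
        rw [hW, ← Finset.mul_sum, ← mul_assoc]
        congr 1
        field_simp

end Replacement

/-! ### Marginal and copula densities -/

section Densities

variable {μ : Measure (ℝ × ℝ)}

theorem densY_nonneg (y : ℝ) : 0 ≤ densY μ y :=
  Monotone.deriv_nonneg (monotone_cdf μ.snd)

/-- A monotone function differentiable everywhere has integrable derivative and satisfies the
fundamental theorem of calculus, without continuity of `g`. Half-open intervals then determine the
measure. -/
theorem snd_eq_withDensity [IsProbabilityMeasure μ] (hG' : Differentiable ℝ (cdfY μ)) :
    μ.snd = (volume : Measure ℝ).withDensity fun y => ENNReal.ofReal (densY μ y) := by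
  refine Measure.ext_of_Ioc _ _ fun s t hst => ?_
  have hint : IntervalIntegrable (densY μ) volume s t :=
    intervalIntegral.intervalIntegrable_deriv_of_nonneg hG'.continuous.continuousOn
      (fun z _ => (hG' z).hasDerivAt) fun z _ => densY_nonneg z
  have hftc : ∫ z in s..t, densY μ z = cdfY μ t - cdfY μ s :=
    intervalIntegral.integral_eq_sub_of_hasDerivAt (fun z _ => (hG' z).hasDerivAt) hint
  rw [withDensity_apply _ measurableSet_Ioc,
    ← ofReal_integral_eq_lintegral_ofReal
      ((intervalIntegrable_iff_integrableOn_Ioc_of_le hst.le).1 hint)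
      (ae_of_all _ densY_nonneg), ← intervalIntegral.integral_of_le hst.le, hftc]
  conv_lhs => rw [← measure_cdf μ.snd]
  rw [StieltjesFunction.measure_Ioc]
  rfl

theorem hasDensityOn_densY [IsProbabilityMeasure μ] (hG' : Differentiable ℝ (cdfY μ)) :
    HasDensityOn μ.snd (densY μ) univ where
  measurable := measurable_deriv _
  measurableSet := MeasurableSet.univ
  nonneg z _ := densY_nonneg z
  restrict_eq := by
    rw [Measure.restrict_univ, Measure.restrict_univ]
    exact snd_eq_withDensity hG'

theorem IsCopulaDensity.hasDensityOn {c : ℝ × ℝ → ℝ} (hc : IsCopulaDensity μ c) :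
    HasDensityOn (μ.map fun p => (cdfX μ p.1, cdfY μ p.2)) c (Icc 0 1 ×ˢ Icc 0 1) where
  measurable := hc.measurable
  measurableSet := measurableSet_Icc.prod measurableSet_Icc
  nonneg z _ := hc.nonneg z
  restrict_eq := by
    have h : MeasurableSet (Icc (0 : ℝ) 1 ×ˢ Icc (0 : ℝ) 1) :=
      measurableSet_Icc.prod measurableSet_Icc
    rw [hc.law_eq, restrict_withDensity h, Measure.restrict_restrict h, inter_self]

/-- Small squares have mass of the order of their area. -/
theorem IsCopulaDensity.exists_box_bound {c : ℝ × ℝ → ℝ} (hc : IsCopulaDensity μ c)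
    (hFc : Continuous (cdfX μ)) (hGc : Continuous (cdfY μ)) {x y : ℝ}
    (hcc : ContinuousAt c (cdfX μ x, cdfY μ y)) :
    ∃ C > 0, ∃ δ > 0, ∀ t, 0 < t → t < δ →
      μ.real {p | |cdfX μ x - cdfX μ p.1| ≤ t ∧ |cdfY μ y - cdfY μ p.2| ≤ t} ≤ C * t ^ 2 := by
  set p₀ : ℝ × ℝ := (cdfX μ x, cdfY μ y) with hp₀
  have hc0 := hc.nonneg p₀
  obtain ⟨δ, hδ, hball⟩ := Metric.eventually_nhds_iff_ball.1
    (hcc.eventually (Iio_mem_nhds (lt_add_one (c p₀))))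
  -- Near `p₀` the density is below `c p₀ + 1`, and the square of half-side `t` has area `4 * t ^
  -- 2`.
  refine ⟨(c p₀ + 1) * 4, by positivity, δ, hδ, fun t ht htδ => ?_⟩
  have hT : Measurable fun p : ℝ × ℝ => (cdfX μ p.1, cdfY μ p.2) := by
    have h₁ := hFc.measurable
    have h₂ := hGc.measurable
    fun_prop
  have hset : {p : ℝ × ℝ | |cdfX μ x - cdfX μ p.1| ≤ t ∧ |cdfY μ y - cdfY μ p.2| ≤ t}
      = (fun p => (cdfX μ p.1, cdfY μ p.2)) ⁻¹' Metric.closedBall p₀ t := by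
    ext p
    simp [hp₀, Prod.dist_eq, Real.dist_eq, abs_sub_comm]
  have hcb : MeasurableSet (Metric.closedBall p₀ t) := Metric.isClosed_closedBall.measurableSet
  have hvol : volume (Metric.closedBall p₀ t) = ENNReal.ofReal (4 * t ^ 2) := by
    rw [hp₀, ← closedBall_prod_same, Measure.volume_eq_prod, Measure.prod_prod,
      Real.volume_closedBall, Real.volume_closedBall, ← ENNReal.ofReal_mul (by positivity)]
    congr 1
    ring
  have hle : μ {p | |cdfX μ x - cdfX μ p.1| ≤ t ∧ |cdfY μ y - cdfY μ p.2| ≤ t}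
      ≤ ENNReal.ofReal ((c p₀ + 1) * 4 * t ^ 2) := by
    rw [hset, ← Measure.map_apply hT hcb, hc.law_eq, withDensity_apply _ hcb]
    calc _ ≤ ∫⁻ p in Metric.closedBall p₀ t, ENNReal.ofReal (c p) :=
          lintegral_mono' (Measure.restrict_mono subset_rfl Measure.restrict_le_self) le_rfl
      _ ≤ ∫⁻ _ in Metric.closedBall p₀ t, ENNReal.ofReal (c p₀ + 1) := by
          refine setLIntegral_mono measurable_const fun p hp => ENNReal.ofReal_le_ofReal ?_
          exact le_of_lt (hball p (Metric.closedBall_subset_ball htδ hp))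
      _ = ENNReal.ofReal ((c p₀ + 1) * 4 * t ^ 2) := by
          rw [setLIntegral_const, hvol, ← ENNReal.ofReal_mul (by positivity)]
          congr 1
          ring
  exact ENNReal.toReal_le_of_le_ofReal (by positivity) hle

end Densities

theorem C2BoundedOn.contDiffAt {E : Type*} [NormedAddCommGroup E] [NormedSpace ℝ E] {φ : E → ℝ}
    {D : Set E} (h : C2BoundedOn φ D) (hD : IsOpen D) {p : E} (hp : p ∈ D) :
    ContDiffAt ℝ 2 φ p :=
  h.1.contDiffAt (hD.mem_nhds hp)

/-- Jordan decomposition into a difference of monotone functions. -/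
theorem measurable_of_boundedVariationOn {K : ℝ → ℝ} (hK : BoundedVariationOn K univ) :
    Measurable K := by
  obtain ⟨p, q, hp, hq, rfl⟩ :=
    hK.locallyBoundedVariationOn.exists_monotoneOn_sub_monotoneOn
  exact (monotoneOn_univ.1 hp).measurable.sub (monotoneOn_univ.1 hq).measurable

/-- A boundedly supported function with continuous derivative is Lipschitz. -/
theorem exists_lipschitz_bound {E : Type*} [NormedAddCommGroup E] [NormedSpace ℝ E]
    [ProperSpace E] {K : E → ℝ} (hd : Differentiable ℝ K)
    (hd' : Continuous (fderiv ℝ K)) (hs : Bornology.IsBounded (Function.support K)) :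
    ∃ L ≥ 0, ∀ z w, |K z - K w| ≤ L * ‖z - w‖ := by
  have hcs : HasCompactSupport K := hs.isCompact_closure
  obtain ⟨L, hL⟩ := (hcs.fderiv ℝ).exists_bound_of_continuous hd'
  refine ⟨L, (norm_nonneg _).trans (hL 0), fun z w => ?_⟩
  exact convex_univ.norm_image_sub_le_of_norm_fderiv_le (fun v _ => hd v) (fun v _ => hL v)
    (mem_univ w) (mem_univ z)

/-! ### Power bandwidths -/

section Rates

theorem OrderEquiv.exists_bounds {u v : ℕ → ℝ} (h : OrderEquiv u v) (hv : ∀ n, 0 ≤ v n) :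
    ∃ κ > 0, ∃ κ' > 0, ∀ᶠ n in atTop, κ * v n ≤ u n ∧ u n ≤ κ' * v n := by
  obtain ⟨k, l, hl, hk, hu⟩ := h
  refine ⟨l / 2, by positivity, 2 * l, by positivity, ?_⟩
  filter_upwards [hk.eventually (Ioo_mem_nhds (half_lt_self hl) (by linarith : l < 2 * l)),
    eventually_ge_atTop 1] with n hkn hn
  rw [hu n hn]
  exact ⟨mul_le_mul_of_nonneg_right hkn.1.le (hv n), mul_le_mul_of_nonneg_right hkn.2.le (hv n)⟩

theorem tendsto_zero_of_le_rpow {u : ℕ → ℝ} {κ β : ℝ} (hβ : 0 < β)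
    (hpos : ∀ᶠ n in atTop, 0 < u n) (h : ∀ᶠ n : ℕ in atTop, u n ≤ κ * (n : ℝ) ^ (-β)) :
    Tendsto u atTop (𝓝 0) := by
  have hlim : Tendsto (fun n : ℕ => κ * (n : ℝ) ^ (-β)) atTop (𝓝 0) := by
    simpa using ((tendsto_rpow_neg_atTop hβ).comp tendsto_natCast_atTop_atTop).const_mul κ
  exact tendsto_of_tendsto_of_tendsto_of_le_of_le' tendsto_const_nhds hlim
    (hpos.mono fun _ => le_of_lt) h

theorem tendsto_atTop_of_rpow_le {u : ℕ → ℝ} {κ β : ℝ} (hκ : 0 < κ) (hβ : 0 < β)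
    (h : ∀ᶠ n : ℕ in atTop, κ * (n : ℝ) ^ β ≤ u n) : Tendsto u atTop atTop :=
  tendsto_atTop_mono' _ h
    (((tendsto_rpow_atTop hβ).comp tendsto_natCast_atTop_atTop).const_mul_atTop hκ)

/-- Applied with `α = 4 / 5` for `n h` and the critical `α = 2 / 3` for `n a²`: the bivariate factor
alone dictates the rate. -/
theorem one_div_sqrt_le_rpow {N q κ α : ℝ} (hN : 1 ≤ N) (hκ : 0 < κ) (hα : 2 / 3 ≤ α)
    (h : κ * N ^ α ≤ q) : 1 / √q ≤ 1 / √κ * N ^ (-(1 / 3) : ℝ) := by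
  have hN0 : 0 < N := by linarith
  have hp : 0 < N ^ (1 / 3 : ℝ) := by positivity
  have hsq : (N ^ (1 / 3 : ℝ)) ^ 2 ≤ N ^ α := by
    rw [← Real.rpow_natCast, ← Real.rpow_mul hN0.le]
    exact Real.rpow_le_rpow_of_exponent_le hN (by push_cast; linarith)
  have hs : √κ * N ^ (1 / 3 : ℝ) ≤ √q := by
    rw [← Real.sqrt_sq hp.le, ← Real.sqrt_mul hκ.le]
    exact Real.sqrt_le_sqrt ((mul_le_mul_of_nonneg_left hsq hκ.le).trans h)
  rw [Real.rpow_neg hN0.le, ← one_div, div_mul_div_comm, one_mul]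
  exact one_div_le_one_div_of_le (by positivity) hs

theorem sq_le_rpow {N b κ β : ℝ} (hN : 1 ≤ N) (hb : 0 ≤ b) (hβ : 1 / 6 ≤ β)
    (h : b ≤ κ * N ^ (-β)) : b ^ 2 ≤ κ ^ 2 * N ^ (-(1 / 3) : ℝ) := by
  have hN0 : 0 < N := by linarith
  refine (pow_le_pow_left₀ hb h 2).trans ?_
  rw [mul_pow, ← Real.rpow_natCast (N ^ (-β)), ← Real.rpow_mul hN0.le]
  refine mul_le_mul_of_nonneg_left ?_ (sq_nonneg κ)
  exact Real.rpow_le_rpow_of_exponent_le hN (by push_cast; linarith)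

end Rates

/-- The pointwise rate of convergence of the quantile-copula estimator. -/
theorem isBigOP_condEstimator_sub
    {Ω : Type*} [MeasurableSpace Ω] {P : Measure Ω} [IsProbabilityMeasure P]
    {μ : Measure (ℝ × ℝ)} [IsProbabilityMeasure μ]
    {X Y : ℕ → Ω → ℝ} (hX : ∀ i, Measurable (X i)) (hY : ∀ i, Measurable (Y i))
    (hindep : iIndepFun (fun i ω => (X i ω, Y i ω)) P)
    (hlaw : ∀ i, P.map (fun ω => (X i ω, Y i ω)) = μ)
    (hF : StrictMono (cdfX μ)) (hFc : Continuous (cdfX μ))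
    (hG : StrictMono (cdfY μ)) (hG' : Differentiable ℝ (cdfY μ))
    {c : ℝ × ℝ → ℝ} (hc : IsCopulaDensity μ c) {x y : ℝ} (hx : densX μ x ≠ 0)
    (hg2 : ContDiffAt ℝ 2 (densY μ) y) (hc2 : ContDiffAt ℝ 2 c (cdfX μ x, cdfY μ y))
    {K₀ : ℝ → ℝ} {K : ℝ × ℝ → ℝ} (hK₀ : IsFirstOrderKernel K₀) (hK₀m : Measurable K₀)
    (hK : IsFirstOrderKernel K) (hK2 : TwiceDiffBounded K)
    {h a : ℕ → ℝ} (hpos : ∀ᶠ n in atTop, 0 < h n) (apos : ∀ᶠ n in atTop, 0 < a n)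
    (h0 : Tendsto h atTop (𝓝 0)) (a0 : Tendsto a atTop (𝓝 0))
    (hna : Tendsto (fun n : ℕ => (n : ℝ) * a n ^ 2) atTop atTop) :
    IsBigOP P
      (fun n ω => condEstimator K₀ K n (h n) (a n) (fun i => X i ω) (fun i => Y i ω) x y
        - condDensity μ c x y)
      (fun n => 1 / √((n : ℝ) * h n) + h n ^ 2 + 1 / √((n : ℝ) * a n ^ 2) + a n ^ 2) := by
  have hGc := hG'.continuous
  have hT : Measurable fun p : ℝ × ℝ => (cdfX μ p.1, cdfY μ p.2) := by
    have h₁ := hFc.measurable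
    have h₂ := hGc.measurable
    fun_prop
  have hZ : ∀ i, Measurable fun ω => (X i ω, Y i ω) := fun i => (hX i).prodMk (hY i)
  have hg : IsBigOP P (fun n ω => kde K₀ n (h n) (fun i => Y i ω) y - densY μ y)
      (fun n => 1 / √((n : ℝ) * h n) + h n ^ 2) := by
    have hind : iIndepFun Y P := hindep.comp (fun _ => Prod.snd) fun _ => measurable_snd
    have hl : ∀ i, P.map (Y i) = μ.snd := fun i => by
      rw [← hlaw i, Measure.snd, Measure.map_map measurable_snd (hZ i)]
      rfl
    have := isBigOP_kernelAverage hY hind hl hK₀ hK₀m hg2 univ_mem (hasDensityOn_densY hG')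
      hpos h0
    simpa only [kde, Module.finrank_self, pow_one, smul_eq_mul, inv_mul_eq_div] using this
  have hcop : IsBigOP P (fun n ω => 1 / (n * a n ^ 2) * ∑ i ∈ Finset.range n,
        K ((cdfX μ x - cdfX μ (X i ω)) / a n, (cdfY μ y - cdfY μ (Y i ω)) / a n)
        - c (cdfX μ x, cdfY μ y))
      (fun n => 1 / √((n : ℝ) * a n ^ 2) + a n ^ 2) := by
    have hind : iIndepFun (fun i ω => (cdfX μ (X i ω), cdfY μ (Y i ω))) P :=
      hindep.comp (fun _ p => (cdfX μ p.1, cdfY μ p.2)) fun _ => hT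
    have hl : ∀ i, P.map (fun ω => (cdfX μ (X i ω), cdfY μ (Y i ω)))
        = μ.map fun p => (cdfX μ p.1, cdfY μ p.2) := fun i => by
      have := Measure.map_map (μ := P) hT (hZ i)
      rw [hlaw i] at this
      exact this.symm
    have hU : Icc (0 : ℝ) 1 ×ˢ Icc (0 : ℝ) 1 ∈ 𝓝 (cdfX μ x, cdfY μ y) :=
      prod_mem_nhds (Icc_mem_nhds (cdf_mem_Ioo hF x).1 (cdf_mem_Ioo hF x).2)
        (Icc_mem_nhds (cdf_mem_Ioo hG y).1 (cdf_mem_Ioo hG y).2)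
    have := isBigOP_kernelAverage (fun i => hT.comp (hZ i)) hind hl hK
      hK2.1.continuous.measurable hc2 hU hc.hasDensityOn apos a0
    simpa only [Module.finrank_prod, Module.finrank_self, one_add_one_eq_two, Function.comp_apply,
      Prod.mk_sub_mk,
      Prod.smul_mk, smul_eq_mul, inv_mul_eq_div] using this
  obtain ⟨L, hL, hlip⟩ := exists_lipschitz_bound hK2.1 hK2.2.1.continuous hK.bounded_support
  obtain ⟨R, hR, hsupp⟩ := hK.exists_radius
  obtain ⟨C, hC, δ, hδ, hbox⟩ := hc.exists_box_bound hFc hGc hc2.continuousAt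
  have hrep := isBigOP_copulaEstimator_sub hX hY hindep hlaw hF hFc hG hGc x y hL hlip hR hsupp
    hC hδ hbox apos a0 hna
  have hchat := (hrep.add hcop (Eventually.of_forall fun n => by positivity)
    (Eventually.of_forall fun n => by positivity)).mono_rate
    (s := fun n => 1 / √((n : ℝ) * a n ^ 2) + a n ^ 2) two_pos (Eventually.of_forall fun n => by
      nlinarith [sq_nonneg (a n)])
  have hr₁ : ∀ᶠ n : ℕ in atTop, 0 ≤ 1 / √((n : ℝ) * h n) + h n ^ 2 :=
    Eventually.of_forall fun n => by positivity
  have hr₂ : ∀ᶠ n : ℕ in atTop, 0 ≤ 1 / √((n : ℝ) * a n ^ 2) + a n ^ 2 :=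
    Eventually.of_forall fun n => by positivity
  -- A copula rate below `1` makes the product of the two errors no larger than the marginal rate;
  -- hence the final factor `2`.
  have hr₂1 : ∀ᶠ n : ℕ in atTop, 1 / √((n : ℝ) * a n ^ 2) + a n ^ 2 < 1 := by
    have hlim : Tendsto (fun n : ℕ => 1 / √((n : ℝ) * a n ^ 2) + a n ^ 2) atTop (𝓝 0) := by
      have h1 : Tendsto (fun n : ℕ => 1 / √((n : ℝ) * a n ^ 2)) atTop (𝓝 0) := by
        simpa only [one_div, Function.comp_def] using
          tendsto_inv_atTop_zero.comp (Real.tendsto_sqrt_atTop.comp hna)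
      simpa using h1.add (a0.pow 2)
    exact hlim.eventually (Iio_mem_nhds one_pos)
  -- The expansion `ĝ ĉ - g c = (ĝ - g)(ĉ - c) + c (ĝ - g) + g (ĉ - c)`.
  have hsum := ((hg.mul hchat hr₁).add (hg.const_mul (c (cdfX μ x, cdfY μ y)) hr₁)
      ((hr₁.and hr₂).mono fun n hn => mul_nonneg hn.1 hn.2) hr₁).add
    (hchat.const_mul (densY μ y) hr₂)
    ((hr₁.and hr₂).mono fun n hn => add_nonneg (mul_nonneg hn.1 hn.2) hn.1) hr₂
  have hfin := hsum.mono_rate two_pos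
    (s := fun n => 1 / √((n : ℝ) * h n) + h n ^ 2 + 1 / √((n : ℝ) * a n ^ 2) + a n ^ 2) (by
      filter_upwards [hr₁, hr₂, hr₂1] with n h₁ h₂ h₃
      nlinarith [mul_le_mul_of_nonneg_left h₃.le h₁])
  convert hfin using 3 with n ω
  have hcd : condDensity μ c x y = densY μ y * c (cdfX μ x, cdfY μ y) := by
    rw [condDensity, jointDensity, mul_assoc, mul_div_cancel_left₀ _ hx]
  rw [hcd, condEstimator]
  ring

end QuantileCopula

end

theorem mainTheorem1
    {Ω : Type*} [MeasurableSpace Ω] (P : Measure Ω) [IsProbabilityMeasure P]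
    -- the i.i.d. sample `(X_i, Y_i)` with common law `μ`
    (μ : Measure (ℝ × ℝ)) [IsProbabilityMeasure μ]
    (X Y : ℕ → Ω → ℝ) (hX : ∀ i, Measurable (X i)) (hY : ∀ i, Measurable (Y i))
    (hindep : iIndepFun (fun i ω => (X i ω, Y i ω)) P)
    (hlaw : ∀ i, P.map (fun ω => (X i ω, Y i ω)) = μ)
    -- `F` and `G` are strictly increasing and differentiable
    (hF : StrictMono (QuantileCopula.cdfX μ)) (hF' : Differentiable ℝ (QuantileCopula.cdfX μ))
    (hG : StrictMono (QuantileCopula.cdfY μ)) (hG' : Differentiable ℝ (QuantileCopula.cdfY μ))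
    -- the copula density
    (c : ℝ × ℝ → ℝ) (hc : QuantileCopula.IsCopulaDensity μ c)
    -- the points `x`, `y`, and the smoothness of `g` and `c`
    (x y : ℝ)
    (hx : x ∈ interior (QuantileCopula.posSupp (QuantileCopula.densX μ)))
    (hy : y ∈ interior (QuantileCopula.posSupp (QuantileCopula.densY μ)))
    (hg2 : QuantileCopula.C2BoundedOn (QuantileCopula.densY μ)
      (interior (QuantileCopula.posSupp (QuantileCopula.densY μ))))
    (D : Set (ℝ × ℝ)) (hD : IsOpen D)
    (hxyD : (QuantileCopula.cdfX μ x, QuantileCopula.cdfY μ y) ∈ D)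
    (hc2 : QuantileCopula.C2BoundedOn c D)
    -- the kernels
    (K₀ K₁ K₂ : ℝ → ℝ)
    (hK₀ : QuantileCopula.IsFirstOrderKernel K₀)
    (hK : QuantileCopula.IsFirstOrderKernel (QuantileCopula.prodKernel K₁ K₂))
    (hK₀bv : BoundedVariationOn K₀ univ)
    (hK₁bv : BoundedVariationOn K₁ univ) (hK₂bv : BoundedVariationOn K₂ univ)
    (hK2 : QuantileCopula.TwiceDiffBounded (QuantileCopula.prodKernel K₁ K₂))
    -- the bandwidths
    (h a : ℕ → ℝ) (hpos : ∀ n, 1 ≤ n → 0 < h n) (apos : ∀ n, 1 ≤ n → 0 < a n) :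
    (Tendsto h atTop (𝓝 0) → Tendsto a atTop (𝓝 0) →
      Tendsto (fun n : ℕ => (n : ℝ) * h n) atTop atTop →
      Tendsto (fun n : ℕ => (n : ℝ) * a n ^ 2) atTop atTop →
      QuantileCopula.IsBigOP P
        (fun n ω => QuantileCopula.condEstimator K₀ (QuantileCopula.prodKernel K₁ K₂) n (h n) (a n)
            (fun i => X i ω) (fun i => Y i ω) x y
          - QuantileCopula.condDensity μ c x y)
        (fun n => 1 / √((n : ℝ) * h n) + h n ^ 2 + 1 / √((n : ℝ) * a n ^ 2) + a n ^ 2)) ∧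
    (QuantileCopula.OrderEquiv h (fun n => (n : ℝ) ^ (-(1 / 5) : ℝ)) →
      QuantileCopula.OrderEquiv a (fun n => (n : ℝ) ^ (-(1 / 6) : ℝ)) →
      QuantileCopula.IsBigOP P
        (fun n ω => QuantileCopula.condEstimator K₀ (QuantileCopula.prodKernel K₁ K₂) n (h n) (a n)
            (fun i => X i ω) (fun i => Y i ω) x y
          - QuantileCopula.condDensity μ c x y)
        (fun n => (n : ℝ) ^ (-(1 / 3) : ℝ))) := by
  have hc2' := hc2.contDiffAt hD hxyD
  have hg2' := hg2.contDiffAt isOpen_interior hy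
  have hxpos : x ∈ QuantileCopula.posSupp (QuantileCopula.densX μ) := interior_subset hx
  have hx' : QuantileCopula.densX μ x ≠ 0 := ne_of_gt hxpos
  have hpos' : ∀ᶠ n in atTop, 0 < h n := (eventually_ge_atTop 1).mono hpos
  have apos' : ∀ᶠ n in atTop, 0 < a n := (eventually_ge_atTop 1).mono apos
  have main := fun h0 a0 hna => QuantileCopula.isBigOP_condEstimator_sub hX hY hindep hlaw hF
    hF'.continuous hG hG' hc hx' hg2' hc2' hK₀
    (QuantileCopula.measurable_of_boundedVariationOn hK₀bv) hK hK2 hpos' apos' h0 a0 hna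
  refine ⟨fun h0 a0 _ hna => main h0 a0 hna, fun hh ha => ?_⟩
  obtain ⟨κ, hκ, κ', hκ', hb⟩ := hh.exists_bounds fun n => by positivity
  obtain ⟨η, hη, η', hη', ab⟩ := ha.exists_bounds fun n => by positivity
  have hnh : ∀ᶠ n : ℕ in atTop, κ * (n : ℝ) ^ (4 / 5 : ℝ) ≤ n * h n := by
    filter_upwards [hb, eventually_ge_atTop 1] with n hn h1
    have hn0 : (0 : ℝ) < n := by positivity
    calc κ * (n : ℝ) ^ (4 / 5 : ℝ) = n * (κ * (n : ℝ) ^ (-(1 / 5) : ℝ)) := by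
          rw [mul_left_comm, ← Real.rpow_one_add' hn0.le (by norm_num)]
          norm_num
      _ ≤ n * h n := by gcongr; exact hn.1
  have hna : ∀ᶠ n : ℕ in atTop, η ^ 2 * (n : ℝ) ^ (2 / 3 : ℝ) ≤ n * a n ^ 2 := by
    filter_upwards [ab, eventually_ge_atTop 1] with n hn h1
    have hn0 : (0 : ℝ) < n := by positivity
    calc η ^ 2 * (n : ℝ) ^ (2 / 3 : ℝ) = n * (η * (n : ℝ) ^ (-(1 / 6) : ℝ)) ^ 2 := by
          rw [mul_pow, mul_left_comm, ← Real.rpow_natCast ((n : ℝ) ^ (-(1 / 6) : ℝ)),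
            ← Real.rpow_mul hn0.le, ← Real.rpow_one_add' hn0.le (by norm_num)]
          norm_num
      _ ≤ n * a n ^ 2 := by gcongr; exact hn.1
  -- Each of the four terms of the rate is at most a constant times `n^{-1/3}`; `C` is the sum of
  -- these constants.
  refine (main
    (QuantileCopula.tendsto_zero_of_le_rpow (by norm_num) hpos' (hb.mono fun _ hn => hn.2))
    (QuantileCopula.tendsto_zero_of_le_rpow (by norm_num) apos' (ab.mono fun _ hn => hn.2))
    (QuantileCopula.tendsto_atTop_of_rpow_le (by positivity) (by norm_num) hna)).mono_rate
    (C := 1 / √κ + κ' ^ 2 + 1 / √(η ^ 2) + η' ^ 2) (by positivity) ?_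
  filter_upwards [hnh, hna, hb, ab, hpos', apos', eventually_ge_atTop 1]
    with n h₁ h₂ h₃ h₄ h₅ h₆ hn
  have hn1 : (1 : ℝ) ≤ n := by exact_mod_cast hn
  have e₁ := QuantileCopula.one_div_sqrt_le_rpow hn1 hκ (by norm_num) h₁
  have e₂ := QuantileCopula.one_div_sqrt_le_rpow hn1 (by positivity) (by norm_num) h₂
  have e₃ := QuantileCopula.sq_le_rpow hn1 h₅.le (by norm_num) h₃.2
  have e₄ := QuantileCopula.sq_le_rpow hn1 h₆.le (by norm_num) h₄.2
  linarith
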